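/- Let $\nabla\wedge$ denote the curl and $\nabla$ the gradient on $\mathbb{R}^3$, both in the sense of distributions. Let $$\mathcal Y := \{A\in L^3(\mathbb{R}^3,\mathbb{R}^3):\ \nabla\wedge A\in L^{3/2}(\mathbb{R}^3,\mathbb{R}^3)\},$$ let $\dot W^{1,3}(\mathbb{R}^3)$ be the space of all real functions $\phi\in L^1_{\rm loc}(\mathbb{R}^3)$ with $\nabla\phi\in L^3(\mathbb{R}^3,\mathbb{R}^3)$, and for $A\in L^3(\mathbb{R}^3,\mathbb{R}^3)$ let $$|||A|||_3 := \inf_{\phi\in\dot W^{1,3}(\mathbb{R}^3)}\|A-\nabla\phi\|_3 .$$ Let $(A_n)\subset\mathcal Y$ be a sequence with $|||A_n|||_3=1$ for all $n$ and $\sup_n\|\nabla\wedge A_n\|_{3/2}<\infty$. Then there are $\lambda_n\in(0,\infty)$ and $a_n\in\mathbb{R}^3$ such that a subsequence of $$x\mapsto \lambda_n^2\,(\nabla\wedge A_n)(\lambda_n(x-a_n))$$ converges weakly in $L^{3/2}(\mathbb{R}^3,\mathbb{R}^3)$ to some $\tilde B\not\equiv 0$. -/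

import Mathlib

open MeasureTheory Filter Topology
open scoped ENNReal NNReal ContDiff

noncomputable section

/-- Euclidean three-space, with the Euclidean norm and Lebesgue measure. -/
abbrev E3 : Type := EuclideanSpace ℝ (Fin 3)

instance fact_one_le_three_halves : Fact ((1 : ℝ≥0∞) ≤ 3 / 2) :=
  ⟨by rw [ENNReal.le_div_iff_mul_le (by simp) (by simp)]; norm_num⟩

/-- Real-valued test functions on `ℝ³`: smooth with compact support. -/
def IsTestFunction (η : E3 → ℝ) : Prop :=
  ContDiff ℝ ∞ η ∧ HasCompactSupport η

/-- The classical `i`-th partial derivative. -/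
def partialDeriv (i : Fin 3) (η : E3 → ℝ) (x : E3) : ℝ :=
  fderiv ℝ η x (EuclideanSpace.single i 1)

/-- `G = ∇φ` in the sense of distributions, where `φ` and `G` are locally integrable. -/
def HasWeakGradient (φ : E3 → ℝ) (G : E3 → E3) : Prop :=
  LocallyIntegrable φ volume ∧ LocallyIntegrable G volume ∧
    ∀ η : E3 → ℝ, IsTestFunction η → ∀ i : Fin 3,
      ∫ x, η x * G x i = -∫ x, partialDeriv i η x * φ x

/-- `B = ∇ ∧ A` in the sense of distributions, where `A` and `B` are locally integrable.
Indices are cyclic (addition in `Fin 3`): `(∇ ∧ A)_i = ∂_{i+1} A_{i+2} - ∂_{i+2} A_{i+1}`. -/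
def HasWeakCurl (A B : E3 → E3) : Prop :=
  LocallyIntegrable A volume ∧ LocallyIntegrable B volume ∧
    ∀ η : E3 → ℝ, IsTestFunction η → ∀ i : Fin 3,
      ∫ x, η x * B x i =
        -∫ x, (partialDeriv (i + 1) η x * A x (i + 2) - partialDeriv (i + 2) η x * A x (i + 1))

/-- The space `𝒴` of fields `A ∈ L³(ℝ³, ℝ³)` with `∇ ∧ A ∈ L^{3/2}(ℝ³, ℝ³)`. -/
def SpaceY : Set (E3 → E3) :=
  {A | MemLp A 3 volume ∧ ∃ B : E3 → E3, HasWeakCurl A B ∧ MemLp B (3 / 2) volume}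

/-- The seminorm `⦀A⦀₃`, the infimum of `‖A - ∇φ‖₃` over the real `φ ∈ L¹_loc` with
`∇φ ∈ L³`. -/
def modGradNorm (A : E3 → E3) : ℝ≥0∞ :=
  sInf {N : ℝ≥0∞ | ∃ (φ : E3 → ℝ) (G : E3 → E3),
    HasWeakGradient φ G ∧ MemLp G 3 volume ∧ N = eLpNorm (fun x => A x - G x) 3 volume}

/-- `u k` converges to `v` weakly in `L^p(ℝ³, ℝ³)`: all functions are in `L^p`, and every
continuous linear functional on `L^p` converges along the sequence. -/
def TendstoWeaklyLp (p : ℝ≥0∞) [Fact (1 ≤ p)] (u : ℕ → E3 → E3) (v : E3 → E3) : Prop :=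
  ∃ (hu : ∀ k, MemLp (u k) p volume) (hv : MemLp v p volume),
    ∀ ℓ : StrongDual ℝ (Lp E3 p (volume : Measure E3)),
      Tendsto (fun k => ℓ ((hu k).toLp (u k))) atTop (𝓝 (ℓ (hv.toLp v)))

end

/-!
Fix a probability density `ρ` and a test field `Ψ` whose divergence is `ρ` minus the dilate of `ρ`
by `2`. Summing dilates of `Ψ` over dyadic scales `t` and integrating by parts writes `A` as a
gradient plus convolutions `t • (Ψ_t ⋆ B)` of its curl `B`, up to averages of `A` that disappear at
very small and at very large scales. If `t ^ 2 * |Ψ_t ⋆ B| ≤ s` at all scales and points, then this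
bound controls the large scales, and truncating `B` at a height adapted to the level set controls
the small ones; the `L³` norm of the sum is then small with `s`. Hence a lower bound on `⦀A⦀₃`
forces `t ^ 2 * |Ψ_t ⋆ B|` to exceed some fixed `s > 0` at a scale `t` and a point `z`. Moving
`(t, z)` to `(1, 0)` by a rescaling turns this quantity into the pairing of the rescaled curl with
a fixed test field, so no weak limit of the rescaled curls can vanish, and weak limits exist since
`L^{3/2}` is reflexive.
-/

/-! ### Duality of `L^p` spaces -/

section Duality

variable {α : Type*} {m : MeasurableSpace α} {μ : Measure α} {p q : ℝ≥0∞}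

theorem le_rpow_of_le_mul_rpow_inv {P Q : ℝ} (hPQ : P.HolderConjugate Q) {I C : ℝ≥0∞}
    (hI : I ≠ ⊤) (h : I ≤ C * I ^ P⁻¹) : I ≤ C ^ Q := by
  rcases eq_or_ne I 0 with rfl | hI0
  · exact zero_le
  rw [← ENNReal.rpow_inv_le_iff hPQ.symm.pos]
  have hpow : I ^ Q⁻¹ * I ^ P⁻¹ = I := by
    rw [← ENNReal.rpow_add _ _ hI0 hI, hPQ.symm.inv_add_inv_eq_one, ENNReal.rpow_one]
  refine (ENNReal.mul_le_mul_iff_left ?_ ?_).1 (hpow.trans_le h)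
  · exact (ENNReal.rpow_pos (pos_iff_ne_zero.2 hI0) hI).ne'
  · exact ENNReal.rpow_ne_top_of_nonneg hPQ.inv_nonneg hI

theorem lintegral_rpow_le_of_forall_simpleFunc [IsFiniteMeasure μ] {P Q : ℝ}
    (hPQ : P.HolderConjugate Q) {f : α → ℝ≥0∞} {C : ℝ≥0∞}
    (h : ∀ φ : SimpleFunc α ℝ≥0, ∫⁻ x, f x * φ x ∂μ ≤ C * (∫⁻ x, (φ x : ℝ≥0∞) ^ P ∂μ) ^ P⁻¹) :
    ∫⁻ x, f x ^ Q ∂μ ≤ C ^ Q := by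
  rw [lintegral_eq_nnreal]
  refine iSup₂_le fun φ hφ => ?_
  rw [← SimpleFunc.lintegral_eq_lintegral, SimpleFunc.coe_map]
  have hfin : ∫⁻ x, (φ x : ℝ≥0∞) ∂μ ≠ ⊤ := by
    obtain ⟨K, hK⟩ := φ.exists_forall_le
    exact ((lintegral_mono fun x => ENNReal.coe_le_coe.2 (hK x)).trans_lt
      (by simp [ENNReal.mul_lt_top])).ne
  refine le_rpow_of_le_mul_rpow_inv hPQ hfin ?_
  calc ∫⁻ x, (φ x : ℝ≥0∞) ∂μ
      ≤ ∫⁻ x, f x * (φ.map (· ^ P⁻¹)) x ∂μ := by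
        refine lintegral_mono fun x => ?_
        have hroot : ((φ x : ℝ≥0∞)) ^ Q⁻¹ ≤ f x :=
          (ENNReal.rpow_inv_le_iff hPQ.symm.pos).2 (hφ x)
        calc (φ x : ℝ≥0∞) = (φ x : ℝ≥0∞) ^ Q⁻¹ * (φ x : ℝ≥0∞) ^ P⁻¹ := by
              rw [← ENNReal.rpow_add_of_nonneg _ _ hPQ.symm.inv_nonneg hPQ.inv_nonneg,
                hPQ.symm.inv_add_inv_eq_one, ENNReal.rpow_one]
          _ ≤ f x * (φ.map (· ^ P⁻¹)) x := by
              rw [SimpleFunc.map_apply, ENNReal.coe_rpow_of_nonneg _ hPQ.inv_nonneg]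
              gcongr
    _ ≤ C * (∫⁻ x, (φ.map (· ^ P⁻¹) x : ℝ≥0∞) ^ P ∂μ) ^ P⁻¹ := h _
    _ = C * (∫⁻ x, (φ x : ℝ≥0∞) ∂μ) ^ P⁻¹ := by
        simp only [SimpleFunc.map_apply, ENNReal.coe_rpow_of_nonneg _ hPQ.inv_nonneg,
          ENNReal.rpow_inv_rpow hPQ.ne_zero]

theorem hasSum_indicatorConstLp_iUnion [IsFiniteMeasure μ] [Fact (1 ≤ p)] (hp : p ≠ ⊤)
    {E : ℕ → Set α} (hE : ∀ i, MeasurableSet (E i)) (hd : Pairwise (Function.onFun Disjoint E)) :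
    HasSum (fun i => indicatorConstLp p (hE i) (measure_ne_top μ (E i)) (1 : ℝ))
      (indicatorConstLp p (.iUnion hE) (measure_ne_top μ _) 1) := by
  have hsum (F : Finset ℕ) :
      indicatorConstLp p (F.measurableSet_biUnion fun i _ => hE i) (measure_ne_top μ _) (1 : ℝ) =
        ∑ i ∈ F, indicatorConstLp p (hE i) (measure_ne_top μ (E i)) (1 : ℝ) := by
    induction F using Finset.induction_on with
    | empty => simp
    | insert a F ha ih =>
      rw [Finset.sum_insert ha, ← ih, ← indicatorConstLp_disjoint_union]
      · simp only [Finset.set_biUnion_insert]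
      · exact Set.disjoint_iUnion₂_right.2 fun i hi => hd (ne_of_mem_of_not_mem hi ha).symm
  have hlim : Tendsto (fun F : Finset ℕ => μ (symmDiff (⋃ i ∈ F, E i) (⋃ i, E i))) atTop
      (𝓝 0) := by
    have hpart : Tendsto (fun F : Finset ℕ => μ (⋃ i, E i) - ∑ i ∈ F, μ (E i)) atTop (𝓝 0) := by
      rw [measure_iUnion hd hE, ← tsub_self (∑' i, μ (E i))]
      refine ENNReal.Tendsto.sub tendsto_const_nhds ENNReal.summable.hasSum (.inl ?_)
      exact (measure_iUnion hd hE (μ := μ)).symm ▸ measure_ne_top μ _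
    refine hpart.congr fun F => ?_
    have hsub : ⋃ i ∈ F, E i ⊆ ⋃ i, E i := Set.iUnion₂_subset fun i _ => Set.subset_iUnion E i
    rw [symmDiff_of_le hsub, measure_sdiff hsub
      (F.measurableSet_biUnion fun i _ => hE i).nullMeasurableSet (measure_ne_top μ _),
      measure_biUnion_finset (hd.set_pairwise _) fun i _ => hE i]
  exact (tendsto_indicatorConstLp_set hp hlim).congr hsum

open Classical in
/-- The signed measure `E ↦ ℓ (1_E)` of a functional `ℓ` on `L^p` of a finite measure. Its density
represents `ℓ`. -/
noncomputable def dualSignedMeasure [IsFiniteMeasure μ] [Fact (1 ≤ p)] (hp : p ≠ ⊤)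
    (ℓ : StrongDual ℝ (Lp ℝ p μ)) : SignedMeasure α where
  measureOf' E :=
    if h : MeasurableSet E then ℓ (indicatorConstLp p h (measure_ne_top μ E) 1) else 0
  empty' := by simp
  not_measurable' E hE := by simp [hE]
  m_iUnion' E hE hd := by
    simpa [hE, MeasurableSet.iUnion hE] using
      (hasSum_indicatorConstLp_iUnion (μ := μ) hp hE hd).mapL ℓ

theorem dualSignedMeasure_apply [IsFiniteMeasure μ] [Fact (1 ≤ p)] (hp : p ≠ ⊤)
    (ℓ : StrongDual ℝ (Lp ℝ p μ)) {E : Set α} (hE : MeasurableSet E) :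
    dualSignedMeasure hp ℓ E = ℓ (indicatorConstLp p hE (measure_ne_top μ E) 1) := by
  simp [dualSignedMeasure, hE]

theorem exists_integrable_dual_indicatorConstLp_eq [IsFiniteMeasure μ] [Fact (1 ≤ p)] (hp : p ≠ ⊤)
    (ℓ : StrongDual ℝ (Lp ℝ p μ)) :
    ∃ h : α → ℝ, Measurable h ∧ Integrable h μ ∧ ∀ (E : Set α) (hE : MeasurableSet E),
      ℓ (indicatorConstLp p hE (measure_ne_top μ E) 1) = ∫ x in E, h x ∂μ := by
  set s := dualSignedMeasure hp ℓ with hs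
  have hac : s ≪ᵥ μ.toENNRealVectorMeasure := by
    refine VectorMeasure.AbsolutelyContinuous.mk fun E hE h0 => ?_
    rw [Measure.toENNRealVectorMeasure_apply_measurable hE] at h0
    have hzero : indicatorConstLp p hE (measure_ne_top μ E) (1 : ℝ) = 0 :=
      Lp.eq_zero_iff_ae_eq_zero.2 (indicatorConstLp_coeFn.trans (indicator_meas_zero h0))
    rw [hs, dualSignedMeasure_apply hp ℓ hE, hzero, map_zero]
  refine ⟨s.rnDeriv μ, SignedMeasure.measurable_rnDeriv _ _, SignedMeasure.integrable_rnDeriv _ _,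
    fun E hE => ?_⟩
  rw [← dualSignedMeasure_apply hp ℓ hE, ← hs,
    ← withDensityᵥ_apply (SignedMeasure.integrable_rnDeriv s μ) hE,
    SignedMeasure.withDensityᵥ_rnDeriv_eq s μ hac]

theorem dual_toLp_simpleFunc_eq [IsFiniteMeasure μ] [Fact (1 ≤ p)] {ℓ : StrongDual ℝ (Lp ℝ p μ)}
    {h : α → ℝ} (hh : Integrable h μ)
    (hℓ : ∀ (E : Set α) (hE : MeasurableSet E),
      ℓ (indicatorConstLp p hE (measure_ne_top μ E) 1) = ∫ x in E, h x ∂μ)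
    (φ : SimpleFunc α ℝ) :
    ℓ ((φ.memLp_of_isFiniteMeasure p μ).toLp φ) = ∫ x, h x * φ x ∂μ := by
  have hint (ψ : SimpleFunc α ℝ) : Integrable (fun x => h x * ψ x) μ := by
    obtain ⟨C, hC⟩ := ψ.exists_forall_norm_le
    exact hh.mul_bdd (c := C) ψ.aestronglyMeasurable (ae_of_all _ hC)
  induction φ using SimpleFunc.induction with
  | @const c E hE =>
    have hind (x) : (SimpleFunc.piecewise E hE (.const α c) (.const α 0)) x =
        c • E.indicator (fun _ => (1 : ℝ)) x := by
      by_cases hx : x ∈ E <;> simp [hx]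
    have hsmul : (SimpleFunc.memLp_of_isFiniteMeasure _ p μ).toLp
        (SimpleFunc.piecewise E hE (.const α c) (.const α 0)) =
        c • indicatorConstLp p hE (measure_ne_top μ E) (1 : ℝ) := by
      rw [indicatorConstLp, ← MemLp.toLp_const_smul]
      exact MemLp.toLp_congr _ _ (ae_of_all _ hind)
    rw [hsmul, map_smul, hℓ E hE, ← integral_indicator hE, smul_eq_mul, ← integral_const_mul]
    refine integral_congr_ae (ae_of_all _ fun x => ?_)
    by_cases hx : x ∈ E <;> simp [hx, mul_comm]
  | @add φ ψ _ hφ hψ =>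
    have hadd : (SimpleFunc.memLp_of_isFiniteMeasure _ p μ).toLp (φ + ψ) =
        (φ.memLp_of_isFiniteMeasure p μ).toLp φ + (ψ.memLp_of_isFiniteMeasure p μ).toLp ψ := rfl
    rw [hadd, map_add, hφ, hψ, ← integral_add (hint φ) (hint ψ)]
    simp only [SimpleFunc.coe_add, Pi.add_apply, mul_add]

theorem memLp_of_forall_dual_simpleFunc_eq [IsFiniteMeasure μ] [Fact (1 ≤ p)]
    [hpq : p.HolderConjugate q] (hp : p ≠ ⊤) (hq : q ≠ ⊤) {ℓ : StrongDual ℝ (Lp ℝ p μ)}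
    {h : α → ℝ} (hm : Measurable h) (hh : Integrable h μ)
    (hℓ : ∀ φ : SimpleFunc α ℝ,
      ℓ ((φ.memLp_of_isFiniteMeasure p μ).toLp φ) = ∫ x, h x * φ x ∂μ) :
    MemLp h q μ := by
  have hPQ := ENNReal.HolderConjugate.toReal_of_ne_top (p := p) (q := q) hp hq
  have hp0 : p ≠ 0 := (zero_lt_one.trans_le Fact.out).ne'
  have hq0 : q ≠ 0 := fun h0 => hPQ.symm.ne_zero (by simp [h0])
  refine ⟨hm.aestronglyMeasurable, ?_⟩
  rw [eLpNorm_lt_top_iff_lintegral_rpow_enorm_lt_top hq0 hq]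
  refine (lintegral_rpow_le_of_forall_simpleFunc hPQ (C := ‖ℓ‖ₑ) fun φ => ?_).trans_lt
    (ENNReal.rpow_lt_top_of_nonneg hPQ.symm.nonneg enorm_ne_top)
  let ψ : SimpleFunc α ℝ := .piecewise {x | 0 ≤ h x} (measurableSet_le measurable_const hm)
    (φ.map (↑)) (-φ.map (↑))
  have hψ (x) : h x * ψ x = |h x| * φ x := by
    by_cases hx : 0 ≤ h x
    · simp [ψ, hx, abs_of_nonneg hx]
    · simp [ψ, hx, abs_of_neg (not_le.1 hx)]
  have hψ_norm (x) : ‖ψ x‖ₑ = φ x := by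
    by_cases hx : 0 ≤ h x <;> simp [ψ, hx]
  obtain ⟨K, hK⟩ := φ.exists_forall_le
  calc ∫⁻ x, ‖h x‖ₑ * φ x ∂μ = ENNReal.ofReal (∫ x, h x * ψ x ∂μ) := by
        rw [ofReal_integral_eq_lintegral_ofReal]
        · refine lintegral_congr fun x => ?_
          rw [hψ, ENNReal.ofReal_mul (abs_nonneg _), Real.enorm_eq_ofReal_abs,
            ENNReal.ofReal_coe_nnreal]
        · refine hh.mul_bdd (c := K) ψ.aestronglyMeasurable (ae_of_all _ fun x => ?_)
          have hbound : ‖ψ x‖ₑ ≤ K := (hψ_norm x).trans_le (ENNReal.coe_le_coe.2 (hK x))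
          exact NNReal.coe_le_coe.2 (ENNReal.coe_le_coe.1 hbound)
        · exact ae_of_all _ fun x => by simp only [hψ]; positivity
    _ = ENNReal.ofReal (ℓ ((ψ.memLp_of_isFiniteMeasure p μ).toLp ψ)) := by rw [hℓ]
    _ ≤ ‖ℓ ((ψ.memLp_of_isFiniteMeasure p μ).toLp ψ)‖ₑ := Real.ofReal_le_enorm _
    _ ≤ ‖ℓ‖ₑ * ‖(ψ.memLp_of_isFiniteMeasure p μ).toLp ψ‖ₑ := ℓ.le_opENorm _
    _ = ‖ℓ‖ₑ * (∫⁻ x, (φ x : ℝ≥0∞) ^ p.toReal ∂μ) ^ p.toReal⁻¹ := by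
        rw [Lp.enorm_toLp, eLpNorm_eq_lintegral_rpow_enorm_toReal hp0 hp, one_div]
        simp only [hψ_norm]

theorem surjective_lpPairing_mul_of_isFiniteMeasure [IsFiniteMeasure μ] [Fact (1 ≤ p)]
    [Fact (1 ≤ q)] [hpq : p.HolderConjugate q] (hp : p ≠ ⊤) (hq : q ≠ ⊤) :
    Function.Surjective ((ContinuousLinearMap.mul ℝ ℝ).lpPairing μ p q) := by
  intro ℓ
  have hqp : q.HolderConjugate p := hpq.symm
  obtain ⟨h, hm, hh, hℓ⟩ := exists_integrable_dual_indicatorConstLp_eq hq ℓ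
  have hLp : MemLp h p μ :=
    memLp_of_forall_dual_simpleFunc_eq hq hp hm hh (dual_toLp_simpleFunc_eq hh hℓ)
  refine ⟨hLp.toLp h, ContinuousLinearMap.ext fun f => ?_⟩
  refine congrFun ((Lp.simpleFunc.denseRange hq).equalizer (ContinuousLinearMap.continuous _)
    ℓ.continuous (funext fun φ => ?_)) f
  let ψ := Lp.simpleFunc.toSimpleFunc φ
  have hψ : (φ : Lp ℝ q μ) = (ψ.memLp_of_isFiniteMeasure q μ).toLp ψ :=
    congrArg Subtype.val (Lp.simpleFunc.toLp_toSimpleFunc φ).symm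
  rw [Function.comp_apply, Function.comp_apply, hψ, dual_toLp_simpleFunc_eq hh hℓ,
    ContinuousLinearMap.lpPairing_eq_integral]
  refine integral_congr_ae ?_
  filter_upwards [hLp.coeFn_toLp, (ψ.memLp_of_isFiniteMeasure q μ).coeFn_toLp] with x hx hx'
  rw [hx, hx', ContinuousLinearMap.mul_apply']

theorem absolutelyContinuous_withDensity_coe_of_pos {g : α → ℝ≥0} (hg : Measurable g)
    (hpos : ∀ x, 0 < g x) : μ ≪ μ.withDensity fun x => g x :=
  withDensity_absolutelyContinuous' hg.coe_nnreal_ennreal.aemeasurable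
    (ae_of_all _ fun x => by simpa using (hpos x).ne')

theorem aestronglyMeasurable_withDensity_coe_iff_of_pos {g : α → ℝ≥0} (hg : Measurable g)
    (hpos : ∀ x, 0 < g x) {f : α → ℝ} :
    AEStronglyMeasurable f (μ.withDensity fun x => g x) ↔ AEStronglyMeasurable f μ :=
  ⟨fun h => h.mono_ac (absolutelyContinuous_withDensity_coe_of_pos hg hpos),
    fun h => h.mono_ac (withDensity_absolutelyContinuous _ _)⟩

theorem eLpNorm_withDensity_coe {g : α → ℝ≥0} (hg : Measurable g) (hp0 : p ≠ 0) (hp : p ≠ ⊤)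
    (f : α → ℝ) :
    eLpNorm f p (μ.withDensity fun x => g x) =
      eLpNorm (fun x => (g x : ℝ) ^ p.toReal⁻¹ * f x) p μ := by
  have hP : p.toReal ≠ 0 := (ENNReal.toReal_pos hp0 hp).ne'
  rw [eLpNorm_eq_lintegral_rpow_enorm_toReal hp0 hp, eLpNorm_eq_lintegral_rpow_enorm_toReal hp0 hp,
    lintegral_withDensity_eq_lintegral_mul_non_measurable _ hg.coe_nnreal_ennreal
      (ae_of_all _ fun x => ENNReal.coe_lt_top)]
  congr 1
  refine lintegral_congr fun x => ?_
  have hroot : ‖(g x : ℝ) ^ p.toReal⁻¹‖ₑ ^ p.toReal = g x := by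
    rw [← NNReal.coe_rpow, NNReal.enorm_eq, ENNReal.coe_rpow_of_nonneg _ (by positivity),
      ENNReal.rpow_inv_rpow hP]
  rw [enorm_mul, ENNReal.mul_rpow_of_nonneg _ _ (by positivity), hroot, Pi.mul_apply]

theorem memLp_withDensity_coe_iff {g : α → ℝ≥0} (hg : Measurable g) (hpos : ∀ x, 0 < g x)
    (hp0 : p ≠ 0) (hp : p ≠ ⊤) {f : α → ℝ} :
    MemLp f p (μ.withDensity fun x => g x) ↔
      MemLp (fun x => (g x : ℝ) ^ p.toReal⁻¹ * f x) p μ := by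
  have hroot : Measurable fun x => (g x : ℝ) ^ p.toReal⁻¹ := hg.coe_nnreal_real.pow_const _
  rw [MemLp, MemLp, ← eLpNorm_withDensity_coe hg hp0 hp,
    aestronglyMeasurable_withDensity_coe_iff_of_pos hg hpos]
  refine and_congr_left fun _ => ⟨hroot.aestronglyMeasurable.mul, fun h => ?_⟩
  refine (hroot.inv.aestronglyMeasurable.mul h).congr (ae_of_all _ fun x => ?_)
  exact inv_mul_cancel_left₀ (Real.rpow_pos_of_pos (hpos x) _).ne' _

/-- Multiplication by the `p`-th root of a positive density `g`, as an isometry from `L^p(g μ)` into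
`L^p(μ)`. It transfers statements from finite to `σ`-finite measures. -/
noncomputable def rootDensityIsometry [Fact (1 ≤ p)] (hp : p ≠ ⊤) {g : α → ℝ≥0}
    (hg : Measurable g) (hpos : ∀ x, 0 < g x) :
    Lp ℝ p (μ.withDensity fun x => g x) →ₗᵢ[ℝ] Lp ℝ p μ :=
  have hp0 : p ≠ 0 := (zero_lt_one.trans_le Fact.out).ne'
  have hac := absolutelyContinuous_withDensity_coe_of_pos (μ := μ) hg hpos
  have hmem (φ : Lp ℝ p (μ.withDensity fun x => g x)) :
      MemLp (fun x => (g x : ℝ) ^ p.toReal⁻¹ * φ x) p μ :=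
    (memLp_withDensity_coe_iff hg hpos hp0 hp).1 (Lp.memLp φ)
  { toFun φ := (hmem φ).toLp _
    map_add' φ ψ := by
      rw [← MemLp.toLp_add]
      refine MemLp.toLp_congr _ _ ?_
      filter_upwards [hac.ae_le (Lp.coeFn_add φ ψ)] with x hx
      simp only [hx, Pi.add_apply, mul_add]
    map_smul' c φ := by
      rw [RingHom.id_apply, ← MemLp.toLp_const_smul]
      refine MemLp.toLp_congr _ _ ?_
      filter_upwards [hac.ae_le (Lp.coeFn_smul c φ)] with x hx
      simp only [hx, Pi.smul_apply, smul_eq_mul, mul_left_comm]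
    norm_map' φ := by
      change ‖(hmem φ).toLp _‖ = ‖φ‖
      rw [Lp.norm_toLp, Lp.norm_def, eLpNorm_withDensity_coe hg hp0 hp] }

theorem coeFn_rootDensityIsometry [Fact (1 ≤ p)] (hp : p ≠ ⊤) {g : α → ℝ≥0}
    (hg : Measurable g) (hpos : ∀ x, 0 < g x) (φ : Lp ℝ p (μ.withDensity fun x => g x)) :
    rootDensityIsometry hp hg hpos φ =ᵐ[μ] fun x => (g x : ℝ) ^ p.toReal⁻¹ * φ x :=
  ((memLp_withDensity_coe_iff hg hpos (zero_lt_one.trans_le Fact.out).ne' hp).1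
    (Lp.memLp φ)).coeFn_toLp

theorem surjective_rootDensityIsometry [Fact (1 ≤ p)] (hp : p ≠ ⊤) {g : α → ℝ≥0}
    (hg : Measurable g) (hpos : ∀ x, 0 < g x) :
    Function.Surjective (rootDensityIsometry (μ := μ) hp hg hpos) := by
  intro f
  have hp0 : p ≠ 0 := (zero_lt_one.trans_le Fact.out).ne'
  have hroot (x) : (g x : ℝ) ^ p.toReal⁻¹ ≠ 0 := (Real.rpow_pos_of_pos (hpos x) _).ne'
  have hφ : MemLp (fun x => ((g x : ℝ) ^ p.toReal⁻¹)⁻¹ * f x) p (μ.withDensity fun x => g x) := by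
    simpa only [memLp_withDensity_coe_iff hg hpos hp0 hp, mul_inv_cancel_left₀ (hroot _)]
      using Lp.memLp f
  refine ⟨hφ.toLp _, Lp.ext ((coeFn_rootDensityIsometry hp hg hpos _).trans ?_)⟩
  filter_upwards [(absolutelyContinuous_withDensity_coe_of_pos hg hpos).ae_le hφ.coeFn_toLp]
    with x hx
  rw [hx, mul_inv_cancel_left₀ (hroot x)]

theorem lpPairing_mul_rootDensityIsometry [Fact (1 ≤ p)] [Fact (1 ≤ q)]
    [hpq : p.HolderConjugate q] (hp : p ≠ ⊤) (hq : q ≠ ⊤) {g : α → ℝ≥0} (hg : Measurable g)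
    (hpos : ∀ x, 0 < g x) (k : Lp ℝ p (μ.withDensity fun x => g x))
    (φ : Lp ℝ q (μ.withDensity fun x => g x)) :
    (ContinuousLinearMap.mul ℝ ℝ).lpPairing μ p q (rootDensityIsometry hp hg hpos k)
        (rootDensityIsometry hq hg hpos φ) =
      (ContinuousLinearMap.mul ℝ ℝ).lpPairing (μ.withDensity fun x => g x) p q k φ := by
  have hPQ := ENNReal.HolderConjugate.toReal_of_ne_top (p := p) (q := q) hp hq
  rw [ContinuousLinearMap.lpPairing_eq_integral, ContinuousLinearMap.lpPairing_eq_integral,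
    integral_withDensity_eq_integral_smul hg]
  refine integral_congr_ae ?_
  filter_upwards [coeFn_rootDensityIsometry hp hg hpos k, coeFn_rootDensityIsometry hq hg hpos φ]
    with x hk hφ
  have hsplit : (g x : ℝ) ^ p.toReal⁻¹ * (g x : ℝ) ^ q.toReal⁻¹ = g x := by
    rw [← Real.rpow_add (NNReal.coe_pos.2 (hpos x)), hPQ.inv_add_inv_eq_one, Real.rpow_one]
  rw [hk, hφ, ContinuousLinearMap.mul_apply', ContinuousLinearMap.mul_apply', mul_mul_mul_comm,
    hsplit, NNReal.smul_def, smul_eq_mul]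

theorem surjective_lpPairing_mul [SigmaFinite μ] [Fact (1 ≤ p)] [Fact (1 ≤ q)]
    [hpq : p.HolderConjugate q] (hp : p ≠ ⊤) (hq : q ≠ ⊤) :
    Function.Surjective ((ContinuousLinearMap.mul ℝ ℝ).lpPairing μ p q) := by
  intro ℓ
  obtain ⟨g, hpos, hg, hfin⟩ := exists_pos_lintegral_lt_of_sigmaFinite μ one_ne_zero
  have := isFiniteMeasure_withDensity (hfin.trans ENNReal.one_lt_top).ne
  obtain ⟨k, hk⟩ := surjective_lpPairing_mul_of_isFiniteMeasure hp hq
    (ℓ.comp (rootDensityIsometry (μ := μ) hq hg hpos).toContinuousLinearMap)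
  refine ⟨rootDensityIsometry hp hg hpos k, ContinuousLinearMap.ext fun f => ?_⟩
  obtain ⟨φ, rfl⟩ := surjective_rootDensityIsometry hq hg hpos f
  rw [lpPairing_mul_rootDensityIsometry, hk]
  rfl

end Duality

/-! ### Weak sequential compactness -/

section WeakCompactness

variable {α ι : Type*} [MeasurableSpace α] [Fintype ι] {μ : Measure α} {p q : ℝ≥0∞}

theorem memLp_toLp_of_forall {g : ι → α → ℝ} (hg : ∀ i, MemLp (g i) p μ) :
    MemLp (fun x => (WithLp.toLp 2 fun i => g i x : EuclideanSpace ℝ ι)) p μ := by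
  classical
  refine (memLp_finsetSum Finset.univ fun i _ => (ContinuousLinearMap.toSpanSingleton ℝ
    (EuclideanSpace.single i (1 : ℝ))).comp_memLp' (hg i)).ae_eq (ae_of_all _ fun x => ?_)
  ext j
  simp [Finset.sum_apply, Pi.single_apply]

theorem surjective_lpPairing_innerSL [SigmaFinite μ] [Fact (1 ≤ p)] [Fact (1 ≤ q)]
    [p.HolderConjugate q] (hp : p ≠ ⊤) (hq : q ≠ ⊤) :
    Function.Surjective ((innerSL ℝ (E := EuclideanSpace ℝ ι)).lpPairing μ p q) := by
  classical
  intro ℓ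
  let emb (i : ι) : Lp ℝ q μ →L[ℝ] Lp (EuclideanSpace ℝ ι) q μ :=
    (ContinuousLinearMap.toSpanSingleton ℝ (EuclideanSpace.single i (1 : ℝ))).compLpL q μ
  let pr (i : ι) : Lp (EuclideanSpace ℝ ι) q μ →L[ℝ] Lp ℝ q μ :=
    (EuclideanSpace.proj (𝕜 := ℝ) i).compLpL q μ
  choose g hg using fun i => surjective_lpPairing_mul hp hq (ℓ.comp (emb i))
  have hgLp := memLp_toLp_of_forall fun i => Lp.memLp (g i)
  refine ⟨hgLp.toLp _, ContinuousLinearMap.ext fun f => ?_⟩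
  have hpr (i) : pr i f =ᵐ[μ] fun x => f x i := ContinuousLinearMap.coeFn_compLpL _ f
  have hemb (i) : emb i (pr i f) =ᵐ[μ] fun x => f x i • EuclideanSpace.single i (1 : ℝ) := by
    filter_upwards [ContinuousLinearMap.coeFn_compLpL
      (ContinuousLinearMap.toSpanSingleton ℝ (EuclideanSpace.single i (1 : ℝ))) (pr i f), hpr i]
      with x h h'
    rw [h, h', ContinuousLinearMap.toSpanSingleton_apply]
  have hsum : f = ∑ i, emb i (pr i f) := by
    refine Lp.ext ?_
    filter_upwards [Lp.coeFn_finsetSum Finset.univ fun i => emb i (pr i f), ae_all_iff.2 hemb]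
      with x h h'
    rw [h, Finset.sum_apply]
    ext j
    simp [h', Pi.single_apply]
  calc (innerSL ℝ).lpPairing μ p q (hgLp.toLp _) f = ∫ x, ∑ i, g i x * f x i ∂μ := by
        rw [ContinuousLinearMap.lpPairing_eq_integral]
        refine integral_congr_ae ?_
        filter_upwards [hgLp.coeFn_toLp] with x hx
        change inner ℝ (_ : EuclideanSpace ℝ ι) _ = _
        simp [hx, PiLp.inner_apply, mul_comm]
    _ = ∑ i, ∫ x, g i x * f x i ∂μ := integral_finsetSum _ fun i _ =>
        (Lp.memLp (g i)).integrable_mul (q := q) ((memLp_congr_ae (hpr i)).1 (Lp.memLp _))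
    _ = ∑ i, ℓ (emb i (pr i f)) := by
        refine Finset.sum_congr rfl fun i _ => ?_
        rw [← ContinuousLinearMap.comp_apply, ← hg i, ContinuousLinearMap.lpPairing_eq_integral]
        refine integral_congr_ae ?_
        filter_upwards [hpr i] with x hx
        rw [hx, ContinuousLinearMap.mul_apply']
    _ = ℓ f := by rw [← map_sum, ← hsum]

theorem exists_subseq_tendsto_dual [SigmaFinite μ] [IsSeparable μ] [Fact (1 ≤ p)] [Fact (1 ≤ q)]
    [p.HolderConjugate q] (hp : p ≠ ⊤) (hq : q ≠ ⊤) {u : ℕ → Lp (EuclideanSpace ℝ ι) p μ} {C : ℝ}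
    (hu : ∀ n, ‖u n‖ ≤ C) :
    ∃ (v : Lp (EuclideanSpace ℝ ι) p μ) (ns : ℕ → ℕ), StrictMono ns ∧
      ∀ ℓ : StrongDual ℝ (Lp (EuclideanSpace ℝ ι) p μ),
        Tendsto (fun k => ℓ (u (ns k))) atTop (𝓝 (ℓ v)) := by
  have : q.HolderConjugate p := ENNReal.HolderConjugate.symm
  have : Fact (q ≠ ⊤) := ⟨hq⟩
  let Φ : Lp (EuclideanSpace ℝ ι) p μ →L[ℝ] StrongDual ℝ (Lp (EuclideanSpace ℝ ι) q μ) :=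
    (innerSL ℝ).lpPairing μ p q
  have hΦ_mem (n) : StrongDual.toWeakDual (Φ (u n)) ∈
      WeakDual.toStrongDual ⁻¹' Metric.closedBall (0 : StrongDual ℝ (Lp (EuclideanSpace ℝ ι) q μ))
        (‖Φ‖ * C) := by
    simp only [Set.mem_preimage, mem_closedBall_zero_iff]
    exact (Φ.le_opNorm _).trans (by gcongr; exact hu n)
  obtain ⟨Λ, -, ns, hns, hlim⟩ := WeakDual.isSeqCompact_closedBall ℝ _ _ _ hΦ_mem
  obtain ⟨v, hv⟩ := surjective_lpPairing_innerSL hp hq (WeakDual.toStrongDual Λ)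
  refine ⟨v, ns, hns, fun ℓ => ?_⟩
  obtain ⟨g, rfl⟩ := surjective_lpPairing_innerSL hq hp ℓ
  have hsymm (f) : (innerSL ℝ).lpPairing μ q p g f = Φ f g := by
    simp only [Φ, ContinuousLinearMap.lpPairing_eq_integral]
    exact integral_congr_ae (ae_of_all _ fun x => real_inner_comm (f x) (g x))
  have hlim_eval : Tendsto (fun k => Φ (u (ns k)) g) atTop (𝓝 (Λ g)) :=
    ((WeakDual.eval_continuous g).tendsto _).comp hlim
  have hΛ : Λ g = Φ v g := (DFunLike.congr_fun hv g).symm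
  simpa only [hsymm, hΛ] using hlim_eval

end WeakCompactness

/-! ### Convolution with dilated kernels -/

section Convolution

open scoped Convolution

variable {E E' F G ι : Type*} [NormedAddCommGroup E] [NormedAddCommGroup E'] [NormedAddCommGroup F]
  [NormedAddCommGroup G] [NormedSpace ℝ E'] [NormedSpace ℝ F] [NormedSpace ℝ G]
  [MeasurableSpace E] {μ : Measure E} {p : ℝ≥0∞}

theorem rpow_lintegral_mul_le {α : Type*} [MeasurableSpace α] {ν : Measure α} {u v : α → ℝ≥0∞}
    (hu : AEMeasurable u ν) (hv : AEMeasurable v ν) {r : ℝ} (hr : 1 ≤ r) :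
    (∫⁻ x, u x * v x ∂ν) ^ r ≤ (∫⁻ x, u x ∂ν) ^ (r - 1) * ∫⁻ x, u x * v x ^ r ∂ν := by
  have hr0 : 0 < r := by positivity
  have hr1 : 0 ≤ 1 - r⁻¹ := sub_nonneg.2 (inv_le_one_of_one_le₀ hr)
  have hsplit (x) : (u x * v x ^ r) ^ r⁻¹ * u x ^ (1 - r⁻¹) = u x * v x := by
    rw [ENNReal.mul_rpow_of_nonneg _ _ (by positivity), ENNReal.rpow_rpow_inv hr0.ne',
      mul_right_comm, ← ENNReal.rpow_add_of_nonneg _ _ (by positivity) hr1]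
    simp
  have hHolder := ENNReal.lintegral_mul_norm_pow_le (hu.mul (hv.pow_const r)) hu
    (inv_nonneg.2 hr0.le) hr1 (by ring)
  simp only [Pi.mul_apply, hsplit] at hHolder
  refine (ENNReal.rpow_le_rpow hHolder hr0.le).trans_eq ?_
  rw [ENNReal.mul_rpow_of_nonneg _ _ hr0.le, ENNReal.rpow_inv_rpow hr0.ne', ← ENNReal.rpow_mul,
    sub_mul, inv_mul_cancel₀ hr0.ne', one_mul, mul_comm]

theorem enorm_convolution_le (L : E' →L[ℝ] F →L[ℝ] G) (w : E → E') (f : E → F) (x : E) :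
    ‖(w ⋆[L, μ] f) x‖ₑ ≤ ‖L‖ₑ * ∫⁻ y, ‖w y‖ₑ * ‖f (x - y)‖ₑ ∂μ := by
  refine (enorm_integral_le_lintegral_enorm _).trans ?_
  rw [← lintegral_const_mul' _ _ enorm_ne_top]
  refine lintegral_mono fun y => ?_
  rw [← mul_assoc]
  exact L.le_opENorm₂ _ _

variable [BorelSpace E]

theorem lintegral_lintegral_mul_sub [SecondCountableTopology E] [SFinite μ]
    [μ.IsAddRightInvariant] {u v : E → ℝ≥0∞} (hu : AEMeasurable u μ) (hv : AEMeasurable v μ) :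
    ∫⁻ x, ∫⁻ y, u y * v (x - y) ∂μ ∂μ = (∫⁻ y, u y ∂μ) * ∫⁻ x, v x ∂μ := by
  rw [lintegral_lintegral_swap]
  · rw [← lintegral_mul_const'' _ hu]
    refine lintegral_congr fun y => ?_
    have hvy : AEMeasurable (fun x => v (x - y)) μ :=
      hv.comp_quasiMeasurePreserving (measurePreserving_sub_right μ y).quasiMeasurePreserving
    rw [lintegral_const_mul'' _ hvy, lintegral_sub_right_eq_self v]
  · exact hu.comp_snd.mul
      (hv.comp_quasiMeasurePreserving (quasiMeasurePreserving_sub_of_right_invariant μ μ))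

theorem eLpNorm_convolution_le [SecondCountableTopology E] [SFinite μ] [μ.IsAddLeftInvariant]
    [μ.IsNegInvariant] (L : E' →L[ℝ] F →L[ℝ] G) {w : E → E'} {f : E → F} (hw : Integrable w μ)
    (hf : AEStronglyMeasurable f μ) (hp : 1 ≤ p) (hp' : p ≠ ⊤) :
    eLpNorm (w ⋆[L, μ] f) p μ ≤ ‖L‖ₑ * eLpNorm w 1 μ * eLpNorm f p μ := by
  have hp0 : p ≠ 0 := (zero_lt_one.trans_le hp).ne'
  have hr : 1 ≤ p.toReal := by simpa using ENNReal.toReal_mono hp' hp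
  have hr0 : 0 < p.toReal := by positivity
  have hW : eLpNorm w 1 μ ≠ ⊤ := (memLp_one_iff_integrable.2 hw).2.ne
  have hfe (x) : AEMeasurable (fun y => ‖f (x - y)‖ₑ) μ :=
    (hf.comp_quasiMeasurePreserving (quasiMeasurePreserving_sub_left μ x)).enorm
  rw [← ENNReal.rpow_le_rpow_iff hr0, ENNReal.mul_rpow_of_nonneg _ _ hr0.le,
    eLpNorm_eq_lintegral_rpow_enorm_toReal hp0 hp', eLpNorm_eq_lintegral_rpow_enorm_toReal hp0 hp',
    one_div, ENNReal.rpow_inv_rpow hr0.ne', ENNReal.rpow_inv_rpow hr0.ne']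
  set r := p.toReal
  calc ∫⁻ x, ‖(w ⋆[L, μ] f) x‖ₑ ^ r ∂μ
      ≤ ∫⁻ x, ‖L‖ₑ ^ r * eLpNorm w 1 μ ^ (r - 1) * ∫⁻ y, ‖w y‖ₑ * ‖f (x - y)‖ₑ ^ r ∂μ ∂μ := by
        refine lintegral_mono fun x => ?_
        rw [mul_assoc, eLpNorm_one_eq_lintegral_enorm]
        refine (ENNReal.rpow_le_rpow (enorm_convolution_le L w f x) hr0.le).trans ?_
        rw [ENNReal.mul_rpow_of_nonneg _ _ hr0.le]
        gcongr
        exact rpow_lintegral_mul_le hw.aestronglyMeasurable.enorm (hfe x) hr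
    _ = ‖L‖ₑ ^ r * eLpNorm w 1 μ ^ (r - 1) * (eLpNorm w 1 μ * ∫⁻ x, ‖f x‖ₑ ^ r ∂μ) := by
        rw [lintegral_const_mul' _ _ (by finiteness), lintegral_lintegral_mul_sub
          hw.aestronglyMeasurable.enorm (hf.enorm.pow_const r), eLpNorm_one_eq_lintegral_enorm]
    _ = (‖L‖ₑ * eLpNorm w 1 μ) ^ r * ∫⁻ x, ‖f x‖ₑ ^ r ∂μ := by
        rw [ENNReal.mul_rpow_of_nonneg _ _ hr0.le, mul_assoc, mul_assoc, ← mul_assoc (_ ^ (r - 1))]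
        congr 2
        nth_rewrite 2 [← ENNReal.rpow_one (eLpNorm w 1 μ)]
        rw [← ENNReal.rpow_add_of_nonneg _ _ (sub_nonneg.2 hr) zero_le_one, sub_add_cancel]

variable [NormedSpace ℝ E]

/-- The `L¹`-normalised dilate `x ↦ t⁻ᵈ w(x / t)` of a kernel `w`, where `d = dim E`. -/
noncomputable def dilate (t : ℝ) (w : E → ℝ) (x : E) : ℝ :=
  (t ^ Module.finrank ℝ E)⁻¹ * w (t⁻¹ • x)

omit [MeasurableSpace E] [BorelSpace E] in
theorem dilate_dilate (s t : ℝ) (w : E → ℝ) : dilate s (dilate t w) = dilate (s * t) w := by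
  ext x
  simp only [dilate, mul_pow, mul_inv, smul_smul, mul_assoc, mul_comm s⁻¹]

omit [MeasurableSpace E] [BorelSpace E] in
theorem dilate_const_smul (t c : ℝ) (w : E → ℝ) : dilate t (c • w) = c • dilate t w := by
  ext x
  simp only [dilate, Pi.smul_apply, smul_eq_mul, mul_left_comm]

omit [MeasurableSpace E] [BorelSpace E] in
theorem dilate_sub (t : ℝ) (w w' : E → ℝ) : dilate t (w - w') = dilate t w - dilate t w' := by
  ext x
  simp only [dilate, Pi.sub_apply, mul_sub]

omit [MeasurableSpace E] [BorelSpace E] in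
theorem dilate_sum (t : ℝ) (s : Finset ι) (w : ι → E → ℝ) :
    dilate t (∑ k ∈ s, w k) = ∑ k ∈ s, dilate t (w k) := by
  ext x
  simp only [dilate, Finset.sum_apply, Finset.mul_sum]

omit [MeasurableSpace E] [BorelSpace E] in
theorem contDiff_dilate {w : E → ℝ} {n : WithTop ℕ∞} (hw : ContDiff ℝ n w) (t : ℝ) :
    ContDiff ℝ n (dilate t w) :=
  contDiff_const.mul (hw.comp (contDiff_const_smul _))

omit [MeasurableSpace E] [BorelSpace E] in
theorem hasCompactSupport_dilate {w : E → ℝ} (hw : HasCompactSupport w) {t : ℝ} (ht : t ≠ 0) :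
    HasCompactSupport (dilate t w) :=
  (hw.comp_smul (inv_ne_zero ht)).mul_left

variable [FiniteDimensional ℝ E] [μ.IsAddHaarMeasure]

omit [NormedSpace ℝ F] in
theorem eLpNorm_comp_smul (f : E → F) {t : ℝ} (ht : t ≠ 0) (hp : p ≠ ⊤) :
    eLpNorm (fun x => f (t • x)) p μ =
      ENNReal.ofReal |(t ^ Module.finrank ℝ E)⁻¹| ^ (1 / p).toReal * eLpNorm f p μ := by
  have hemb : MeasurableEmbedding fun x : E => t • x :=
    (Homeomorph.smulOfNeZero t ht).measurableEmbedding
  rw [← Function.comp_def, ← hemb.eLpNorm_map_measure, Measure.map_addHaar_smul μ ht,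
    eLpNorm_smul_measure_of_ne_top hp, smul_eq_mul]

theorem integrable_dilate {w : E → ℝ} (hw : Integrable w μ) {t : ℝ} (ht : t ≠ 0) :
    Integrable (dilate t w) μ :=
  (hw.comp_smul (inv_ne_zero ht)).const_mul _

theorem integral_dilate (w : E → ℝ) {t : ℝ} (ht : 0 < t) : ∫ x, dilate t w x ∂μ = ∫ x, w x ∂μ := by
  simp only [dilate]
  rw [integral_const_mul, Measure.integral_comp_inv_smul_of_nonneg μ w ht.le, smul_eq_mul,
    inv_mul_cancel_left₀ (by positivity)]

theorem eLpNorm_dilate (w : E → ℝ) {t : ℝ} (ht : 0 < t) (hp : p ≠ ⊤) :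
    eLpNorm (dilate t w) p μ =
      ENNReal.ofReal (t ^ (Module.finrank ℝ E * ((1 / p).toReal - 1))) * eLpNorm w p μ := by
  change eLpNorm ((t ^ Module.finrank ℝ E)⁻¹ • fun x => w (t⁻¹ • x)) p μ = _
  rw [eLpNorm_const_smul, eLpNorm_comp_smul w (inv_ne_zero ht.ne') hp, ← mul_assoc,
    inv_pow, inv_inv, abs_of_nonneg (by positivity), Real.enorm_of_nonneg (by positivity),
    ENNReal.ofReal_rpow_of_nonneg (by positivity) (by positivity),
    ← ENNReal.ofReal_mul (by positivity)]
  congr 2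
  rw [mul_sub, mul_one, Real.rpow_sub ht, Real.rpow_natCast, Real.rpow_mul ht.le,
    Real.rpow_natCast, div_eq_inv_mul]

theorem eLpNorm_one_dilate (w : E → ℝ) {t : ℝ} (ht : 0 < t) :
    eLpNorm (dilate t w) 1 μ = eLpNorm w 1 μ := by
  rw [eLpNorm_dilate w ht ENNReal.one_ne_top]
  simp

theorem tendsto_eLpNorm_dilate_atTop [Nontrivial E] {w : E → ℝ} (hw : MemLp w p μ) (hp : 1 < p)
    (hp' : p ≠ ⊤) : Tendsto (fun t => eLpNorm (dilate t w) p μ) atTop (𝓝 0) := by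
  have hexp : 0 < Module.finrank ℝ E * (1 - (1 / p).toReal) := by
    refine mul_pos (Nat.cast_pos.2 Module.finrank_pos) (sub_pos.2 ?_)
    rw [one_div, ← ENNReal.toReal_one]
    exact (ENNReal.toReal_lt_toReal (by simp [(zero_lt_one.trans hp).ne']) (by simp)).2
      (ENNReal.inv_lt_one.2 hp)
  have hpow := ENNReal.tendsto_ofReal (tendsto_rpow_neg_atTop hexp)
  rw [ENNReal.ofReal_zero] at hpow
  have hlim := ENNReal.Tendsto.mul_const hpow (Or.inr hw.2.ne)
  rw [zero_mul] at hlim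
  refine hlim.congr' ?_
  filter_upwards [eventually_gt_atTop 0] with t ht
  rw [eLpNorm_dilate w ht hp', ← mul_neg, neg_sub]

theorem tendsto_zero_of_forall_hasCompactSupport {l : Filter ι} {N : ι → (E → F) → ℝ≥0∞}
    {C : ℝ≥0∞} (hC : C ≠ ⊤) (hp : p ≠ ⊤)
    (hN : ∀ᶠ t in l, ∀ f g, MemLp f p μ → MemLp g p μ → N t f ≤ C * eLpNorm (f - g) p μ + N t g)
    (hlim : ∀ g, Continuous g → HasCompactSupport g → Tendsto (N · g) l (𝓝 0))
    {f : E → F} (hf : MemLp f p μ) : Tendsto (N · f) l (𝓝 0) := by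
  refine ENNReal.tendsto_nhds_zero.2 fun ε hε => ?_
  have hε2 : ε / 2 ≠ 0 := (ENNReal.half_pos hε.ne').ne'
  obtain ⟨g, hg_supp, hfg, hg, hg_memLp⟩ := hf.exists_hasCompactSupport_eLpNorm_sub_le hp
    (ENNReal.div_ne_zero.2 ⟨hε2, hC⟩)
  filter_upwards [hN, ENNReal.tendsto_nhds_zero.1 (hlim g hg hg_supp) _ (ENNReal.half_pos hε.ne')]
    with t ht hgt
  calc N t f ≤ C * eLpNorm (f - g) p μ + N t g := ht f g hf hg_memLp
    _ ≤ C * (ε / 2 / C) + ε / 2 := by gcongr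
    _ ≤ ε / 2 + ε / 2 := by gcongr; exact ENNReal.mul_div_le
    _ = ε := ENNReal.add_halves ε

theorem convolutionExists_dilate {w : E → ℝ} {f : E → F} (hw : Continuous w)
    (hw_supp : HasCompactSupport w) (hf : LocallyIntegrable f μ) {t : ℝ} (ht : t ≠ 0) :
    ConvolutionExists (dilate t w) f (ContinuousLinearMap.lsmul ℝ ℝ) μ :=
  (hasCompactSupport_dilate hw_supp ht).convolutionExists_left _
    (contDiff_dilate (contDiff_zero.2 hw) t).continuous hf

theorem continuous_dilate_convolution {w : E → ℝ} {f : E → F} (hw : Continuous w)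
    (hw_supp : HasCompactSupport w) (hf : LocallyIntegrable f μ) {t : ℝ} (ht : t ≠ 0) :
    Continuous (dilate t w ⋆[ContinuousLinearMap.lsmul ℝ ℝ, μ] f) :=
  (hasCompactSupport_dilate hw_supp ht).continuous_convolution_left _
    (contDiff_dilate (contDiff_zero.2 hw) t).continuous hf

theorem eLpNorm_dilate_convolution_le {w : E → ℝ} {f : E → F} (hw : Integrable w μ)
    (hf : AEStronglyMeasurable f μ) {t : ℝ} (ht : 0 < t) (hp : 1 ≤ p) (hp' : p ≠ ⊤) :
    eLpNorm (dilate t w ⋆[ContinuousLinearMap.lsmul ℝ ℝ, μ] f) p μ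
      ≤ eLpNorm w 1 μ * eLpNorm f p μ := by
  have hnorm : ‖(ContinuousLinearMap.lsmul ℝ ℝ : ℝ →L[ℝ] F →L[ℝ] F)‖ₑ ≤ 1 := by
    rw [← ofReal_norm]
    exact ENNReal.ofReal_le_one.2 ContinuousLinearMap.opNorm_lsmul_le
  refine (eLpNorm_convolution_le _ (integrable_dilate hw ht.ne') hf hp hp').trans ?_
  rw [eLpNorm_one_dilate w ht]
  gcongr
  exact mul_le_of_le_one_left zero_le hnorm

omit [BorelSpace E] [NormedSpace ℝ E] [FiniteDimensional ℝ E] [μ.IsAddHaarMeasure] in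
theorem convolution_sub (L : E' →L[ℝ] F →L[ℝ] G) {w : E → E'} {f g : E → F}
    (hf : ConvolutionExists w f L μ) (hg : ConvolutionExists w g L μ) :
    w ⋆[L, μ] (f - g) = w ⋆[L, μ] f - w ⋆[L, μ] g := by
  ext x
  simp only [convolution_def, Pi.sub_apply, map_sub]
  exact integral_sub (hf x) (hg x)

omit [MeasurableSpace E] [BorelSpace E] [FiniteDimensional ℝ E] in
theorem eventually_support_dilate_subset_ball {w : E → ℝ} (hw : HasCompactSupport w) {δ : ℝ}
    (hδ : 0 < δ) : ∀ᶠ t in 𝓝[>] 0, Function.support (dilate t w) ⊆ Metric.ball 0 δ := by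
  obtain ⟨r, hr, hwr⟩ := hw.isCompact.isBounded.subset_ball_lt 0 0
  filter_upwards [Ioo_mem_nhdsGT (div_pos hδ hr)] with t ht x hx
  have hmem := hwr (subset_tsupport w (right_ne_zero_of_mul hx))
  rw [mem_ball_zero_iff, norm_smul, norm_inv, Real.norm_of_nonneg ht.1.le,
    inv_mul_lt_iff₀ ht.1] at hmem
  exact mem_ball_zero_iff.2 (hmem.trans ((lt_div_iff₀ hr).1 ht.2))

theorem eventually_norm_sub_dilate_convolution_le [CompleteSpace F] {w : E → ℝ}
    (hw : HasCompactSupport w) (hw0 : ∀ x, 0 ≤ w x) (hw1 : ∫ x, w x ∂μ = 1) {g : E → F}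
    (hg : Continuous g) (hg_supp : HasCompactSupport g) {ε : ℝ} (hε : 0 < ε) :
    ∀ᶠ t in 𝓝[>] 0, ∀ x, ‖(g - dilate t w ⋆[ContinuousLinearMap.lsmul ℝ ℝ, μ] g) x‖
      ≤ (Metric.cthickening 1 (tsupport g)).indicator (fun _ => ε) x := by
  obtain ⟨δ, hδ, hgδ⟩ := Metric.uniformContinuous_iff.1
    (hg_supp.uniformContinuous_of_continuous hg) ε hε
  filter_upwards [eventually_support_dilate_subset_ball hw (lt_min hδ one_pos),
    self_mem_nhdsWithin] with t hsupp (ht : 0 < t) x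
  have hdist {η : ℝ} (hη : 0 ≤ η) (h : ∀ y ∈ Metric.ball x (min δ 1), dist (g y) (g x) ≤ η) :
      ‖(g - dilate t w ⋆[ContinuousLinearMap.lsmul ℝ ℝ, μ] g) x‖ ≤ η := by
    rw [Pi.sub_apply, ← dist_eq_norm, dist_comm]
    exact dist_convolution_le hη hsupp
      (fun y => mul_nonneg (inv_nonneg.2 (pow_nonneg ht.le _)) (hw0 _))
      ((integral_dilate w ht).trans hw1) hg.aestronglyMeasurable h
  by_cases hx : x ∈ Metric.cthickening 1 (tsupport g)
  · rw [Set.indicator_of_mem hx]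
    exact hdist hε.le fun y hy => (hgδ (hy.trans_le (min_le_left _ _))).le
  · rw [Set.indicator_of_notMem hx]
    have hzero {y} (hy : dist y x ≤ 1) : g y = 0 := by
      by_contra h
      rw [dist_comm] at hy
      exact hx (Metric.mem_cthickening_of_dist_le x y 1 _ (subset_tsupport g h) hy)
    refine hdist le_rfl fun y hy => ?_
    rw [hzero (hy.le.trans (min_le_right _ _)), hzero (by simp), dist_self]

theorem tendsto_eLpNorm_sub_dilate_convolution_of_continuous [CompleteSpace F] {w : E → ℝ}
    (hw : HasCompactSupport w) (hw0 : ∀ x, 0 ≤ w x) (hw1 : ∫ x, w x ∂μ = 1)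
    {g : E → F} (hg : Continuous g) (hg_supp : HasCompactSupport g) :
    Tendsto (fun t => eLpNorm (g - dilate t w ⋆[ContinuousLinearMap.lsmul ℝ ℝ, μ] g) p μ)
      (𝓝[>] 0) (𝓝 0) := by
  set K := Metric.cthickening 1 (tsupport g)
  have hK : μ K ≠ ⊤ := (hg_supp.isCompact.cthickening).measure_lt_top.ne
  refine ENNReal.tendsto_nhds_zero.2 fun δ hδ => ?_
  obtain ⟨ε, hε, hεδ⟩ := ENNReal.exists_nnreal_pos_mul_lt
    (ENNReal.rpow_ne_top_of_nonneg (inv_nonneg.2 p.toReal_nonneg) hK) hδ.ne'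
  filter_upwards [eventually_norm_sub_dilate_convolution_le hw hw0 hw1 hg hg_supp
    (NNReal.coe_pos.2 hε)] with t ht
  calc eLpNorm (g - dilate t w ⋆[ContinuousLinearMap.lsmul ℝ ℝ, μ] g) p μ
      ≤ eLpNorm (K.indicator fun _ => (ε : ℝ)) p μ := eLpNorm_mono_real ht
    _ ≤ ε * μ K ^ p.toReal⁻¹ := by
        simpa only [NNReal.enorm_eq, one_div] using eLpNorm_indicator_const_le (ε : ℝ) p
    _ ≤ δ := hεδ.le

theorem tendsto_eLpNorm_sub_dilate_convolution [CompleteSpace F] {w : E → ℝ} (hwc : Continuous w)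
    (hw : HasCompactSupport w) (hw0 : ∀ x, 0 ≤ w x) (hw1 : ∫ x, w x ∂μ = 1) (hp : 1 ≤ p)
    (hp' : p ≠ ⊤) {f : E → F} (hf : MemLp f p μ) :
    Tendsto (fun t => eLpNorm (f - dilate t w ⋆[ContinuousLinearMap.lsmul ℝ ℝ, μ] f) p μ)
      (𝓝[>] 0) (𝓝 0) := by
  have hwi : Integrable w μ := hwc.integrable_of_hasCompactSupport hw
  refine tendsto_zero_of_forall_hasCompactSupport (C := 1 + eLpNorm w 1 μ)
    (ENNReal.add_ne_top.2 ⟨ENNReal.one_ne_top, (memLp_one_iff_integrable.2 hwi).2.ne⟩) hp' ?_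
    (fun g hg hg_supp =>
      tendsto_eLpNorm_sub_dilate_convolution_of_continuous hw hw0 hw1 hg hg_supp) hf
  filter_upwards [self_mem_nhdsWithin] with t (ht : 0 < t) f g hf hg
  have hconv {h : E → F} (hh : MemLp h p μ) :=
    convolutionExists_dilate hwc hw (hh.locallyIntegrable hp) ht.ne'
  have hmeas {h : E → F} (hh : MemLp h p μ) :=
    (continuous_dilate_convolution hwc hw (hh.locallyIntegrable hp)
      ht.ne').aestronglyMeasurable (μ := μ)
  calc eLpNorm (f - dilate t w ⋆[ContinuousLinearMap.lsmul ℝ ℝ, μ] f) p μ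
      = eLpNorm ((f - g) - dilate t w ⋆[ContinuousLinearMap.lsmul ℝ ℝ, μ] (f - g) +
          (g - dilate t w ⋆[ContinuousLinearMap.lsmul ℝ ℝ, μ] g)) p μ := by
        rw [convolution_sub _ (hconv hf) (hconv hg)]
        congr 1
        abel
    _ ≤ eLpNorm (f - g) p μ + eLpNorm w 1 μ * eLpNorm (f - g) p μ +
          eLpNorm (g - dilate t w ⋆[ContinuousLinearMap.lsmul ℝ ℝ, μ] g) p μ := by
        refine (eLpNorm_add_le ((hf.sub hg).1.sub (hmeas (hf.sub hg))) (hg.1.sub (hmeas hg))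
          hp).trans ?_
        gcongr
        refine (eLpNorm_sub_le (hf.sub hg).1 (hmeas (hf.sub hg)) hp).trans ?_
        gcongr
        exact eLpNorm_dilate_convolution_le hwi (hf.sub hg).1 ht hp hp'
    _ = (1 + eLpNorm w 1 μ) * eLpNorm (f - g) p μ +
          eLpNorm (g - dilate t w ⋆[ContinuousLinearMap.lsmul ℝ ℝ, μ] g) p μ := by
        rw [add_mul, one_mul]

/-- A compactly supported `g` is integrable, so Young's inequality applies with the roles of kernel
and function exchanged. -/
theorem tendsto_eLpNorm_dilate_convolution_atTop_of_continuous [Nontrivial E] {w : E → ℝ}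
    (hwc : Continuous w) (hw : HasCompactSupport w) (hp : 1 < p) (hp' : p ≠ ⊤) {g : E → F}
    (hg : Continuous g) (hg_supp : HasCompactSupport g) :
    Tendsto (fun t => eLpNorm (dilate t w ⋆[ContinuousLinearMap.lsmul ℝ ℝ, μ] g) p μ)
      atTop (𝓝 0) := by
  have hlim := ENNReal.Tendsto.const_mul
    (tendsto_eLpNorm_dilate_atTop (hwc.memLp_of_hasCompactSupport (μ := μ) hw) hp hp')
    (Or.inr (ENNReal.mul_ne_top (enorm_ne_top (x := (ContinuousLinearMap.lsmul ℝ ℝ :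
      ℝ →L[ℝ] F →L[ℝ] F).flip)) (hg.memLp_of_hasCompactSupport (p := 1) (μ := μ) hg_supp).2.ne))
  rw [mul_zero] at hlim
  refine tendsto_of_tendsto_of_tendsto_of_le_of_le tendsto_const_nhds hlim (fun _ => zero_le)
    fun t => ?_
  dsimp only
  rw [← convolution_flip]
  exact eLpNorm_convolution_le _ (hg.integrable_of_hasCompactSupport hg_supp)
    (contDiff_dilate (contDiff_zero.2 hwc) t).continuous.aestronglyMeasurable hp.le hp'

theorem tendsto_eLpNorm_dilate_convolution_atTop [Nontrivial E] {w : E → ℝ} (hwc : Continuous w)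
    (hw : HasCompactSupport w) (hp : 1 < p) (hp' : p ≠ ⊤) {f : E → F} (hf : MemLp f p μ) :
    Tendsto (fun t => eLpNorm (dilate t w ⋆[ContinuousLinearMap.lsmul ℝ ℝ, μ] f) p μ)
      atTop (𝓝 0) := by
  have hwi : Integrable w μ := hwc.integrable_of_hasCompactSupport hw
  refine tendsto_zero_of_forall_hasCompactSupport
    (N := fun t f => eLpNorm (dilate t w ⋆[ContinuousLinearMap.lsmul ℝ ℝ, μ] f) p μ)
    (memLp_one_iff_integrable.2 hwi).2.ne hp' ?_ (fun g hg hg_supp =>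
      tendsto_eLpNorm_dilate_convolution_atTop_of_continuous hwc hw hp hp' hg hg_supp) hf
  filter_upwards [eventually_gt_atTop 0] with t ht f g hf hg
  have hconv {h : E → F} (hh : MemLp h p μ) :=
    convolutionExists_dilate hwc hw (hh.locallyIntegrable hp.le) ht.ne'
  have hmeas {h : E → F} (hh : MemLp h p μ) :=
    (continuous_dilate_convolution hwc hw (hh.locallyIntegrable hp.le)
      ht.ne').aestronglyMeasurable (μ := μ)
  calc eLpNorm (dilate t w ⋆[ContinuousLinearMap.lsmul ℝ ℝ, μ] f) p μ
      = eLpNorm (dilate t w ⋆[ContinuousLinearMap.lsmul ℝ ℝ, μ] (f - g) +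
          dilate t w ⋆[ContinuousLinearMap.lsmul ℝ ℝ, μ] g) p μ := by
        rw [convolution_sub _ (hconv hf) (hconv hg), sub_add_cancel]
    _ ≤ eLpNorm w 1 μ * eLpNorm (f - g) p μ +
          eLpNorm (dilate t w ⋆[ContinuousLinearMap.lsmul ℝ ℝ, μ] g) p μ := by
        refine (eLpNorm_add_le (hmeas (hf.sub hg)) (hmeas hg) hp.le).trans ?_
        gcongr
        exact eLpNorm_dilate_convolution_le hwi (hf.sub hg).1 ht hp.le hp'

end Convolution

/-! ### The potential estimate -/

section PotentialEstimate

open scoped Convolution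

theorem sum_dyadic_lt_le {ε T : ℝ} (hε : 0 < ε) (hT : 0 < T) (n : ℕ) :
    ∑ k ∈ Finset.range n with ε * 2 ^ k < T, ε * 2 ^ k ≤ 2 * T := by
  suffices h : ∑ k ∈ Finset.range n with ε * 2 ^ k < T, ε * 2 ^ k ≤ min (2 * T) (ε * 2 ^ n) from
    h.trans (min_le_left _ _)
  induction n with
  | zero => simpa using ⟨hT.le, hε.le⟩
  | succ n ih =>
    obtain ⟨hT_le, hn_le⟩ := le_min_iff.1 ih
    have hpos : 0 < ε * 2 ^ n := by positivity
    rw [Finset.sum_filter, Finset.sum_range_succ, ← Finset.sum_filter, pow_succ, le_min_iff]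
    split_ifs with h <;> constructor <;> nlinarith

theorem sum_inv_dyadic_ge_le {ε T : ℝ} (hε : 0 < ε) (hT : 0 < T) (n : ℕ) :
    ∑ k ∈ Finset.range n with ¬ ε * 2 ^ k < T, (ε * 2 ^ k)⁻¹ ≤ 2 / T := by
  suffices h : ∑ k ∈ Finset.range n with ¬ ε * 2 ^ k < T, (ε * 2 ^ k)⁻¹ ≤
      max 0 (2 / T - 2 * (ε * 2 ^ n)⁻¹) from
    h.trans (max_le (by positivity) (sub_le_self _ (by positivity)))
  induction n with
  | zero => simp
  | succ n ih =>
    have hpos : 0 < (ε * 2 ^ n)⁻¹ := by positivity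
    have hhalf : (ε * 2 ^ (n + 1))⁻¹ = (ε * 2 ^ n)⁻¹ / 2 := by
      rw [pow_succ, ← mul_assoc, mul_inv, div_eq_mul_inv]
    rw [Finset.sum_filter, Finset.sum_range_succ, ← Finset.sum_filter, hhalf]
    split_ifs with h
    · exact (add_zero _).trans_le (ih.trans (max_le_max le_rfl (by linarith)))
    · have hinv : (ε * 2 ^ n)⁻¹ ≤ T⁻¹ := inv_anti₀ hT (not_lt.1 h)
      rw [div_eq_mul_inv] at ih ⊢
      refine le_max_of_le_right ((add_le_add_left ih _).trans ?_)
      rw [max_eq_right (by linarith)]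
      linarith

theorem sum_dyadic_mul_ge_le {a : ℝ → ℝ} {ε s T : ℝ} (hs : 0 ≤ s)
    (ha : ∀ t, 0 < t → t ^ 2 * a t ≤ s) (hε : 0 < ε) (hT : 0 < T) (n : ℕ) :
    ∑ k ∈ Finset.range n with ¬ ε * 2 ^ k < T, ε * 2 ^ k * a (ε * 2 ^ k) ≤ 2 * s / T := by
  calc ∑ k ∈ Finset.range n with ¬ ε * 2 ^ k < T, ε * 2 ^ k * a (ε * 2 ^ k)
      ≤ ∑ k ∈ Finset.range n with ¬ ε * 2 ^ k < T, s * (ε * 2 ^ k)⁻¹ := by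
        refine Finset.sum_le_sum fun k _ => ?_
        have hpos : 0 < ε * 2 ^ k := by positivity
        rw [← div_eq_mul_inv, le_div_iff₀ hpos]
        linarith [ha _ hpos]
    _ ≤ s * (2 / T) := by
        rw [← Finset.mul_sum]
        gcongr
        exact sum_inv_dyadic_ge_le hε hT n
    _ = 2 * s / T := by ring

/-- The number `y` if it exceeds `r`, and `0` otherwise: `x ↦ aboveLevel r ‖b x‖` is the part of
`‖b‖` above the height `r`. -/
noncomputable def aboveLevel (r y : ℝ) : ℝ≥0∞ :=
  (Set.Ioi r).indicator ENNReal.ofReal y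

theorem measurable_aboveLevel : Measurable fun q : ℝ × ℝ => aboveLevel q.1 q.2 :=
  (ENNReal.measurable_ofReal.comp measurable_snd).indicator
    (measurableSet_lt measurable_fst measurable_snd)

theorem ofReal_le_add_aboveLevel (r y : ℝ) :
    ENNReal.ofReal y ≤ ENNReal.ofReal r + aboveLevel r y := by
  by_cases h : r < y
  · rw [aboveLevel, Set.indicator_of_mem (Set.mem_Ioi.2 h)]
    exact le_add_self
  · exact le_add_right (ENNReal.ofReal_le_ofReal (not_lt.1 h))

theorem setLIntegral_Ioc_ofReal_rpow {q R : ℝ} (hq : -1 < q) (hR : 0 ≤ R) :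
    ∫⁻ τ in Set.Ioc 0 R, ENNReal.ofReal (τ ^ q) = ENNReal.ofReal (R ^ (q + 1) / (q + 1)) := by
  rw [← ofReal_integral_eq_lintegral_ofReal (intervalIntegral.intervalIntegrable_rpow' hq).1
    ((ae_restrict_mem measurableSet_Ioc).mono fun τ hτ => Real.rpow_nonneg hτ.1.le _),
    ← intervalIntegral.integral_of_le hR, integral_rpow (Or.inl hq),
    Real.zero_rpow (by linarith), sub_zero]

theorem lintegral_rpow_mul_aboveLevel_le {p c y : ℝ} (hp : 1 < p) (hc : 0 < c) (hy : 0 ≤ y) :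
    ∫⁻ τ in Set.Ioi 0, ENNReal.ofReal (τ ^ (2 * p - 3)) * aboveLevel (τ ^ 2 / c) y ≤
      ENNReal.ofReal (c ^ (p - 1) / (2 * p - 2)) * ENNReal.ofReal y ^ p := by
  set R := √(c * y) with hR
  set f : ℝ → ℝ≥0∞ := fun τ => ENNReal.ofReal (τ ^ (2 * p - 3)) * ENNReal.ofReal y
  have hpoint (τ : ℝ) (hτ : τ ∈ Set.Ioi 0) :
      ENNReal.ofReal (τ ^ (2 * p - 3)) * aboveLevel (τ ^ 2 / c) y ≤
        (Set.Ioc 0 R).indicator f τ := by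
    by_cases h : τ ^ 2 / c < y
    · have hmem : τ ∈ Set.Ioc 0 R := by
        refine ⟨hτ, Real.le_sqrt_of_sq_le ?_⟩
        rw [div_lt_iff₀ hc, mul_comm] at h
        exact h.le
      rw [Set.indicator_of_mem hmem]
      simp only [f]
      gcongr
      exact Set.indicator_le_self _ _ _
    · rw [aboveLevel, Set.indicator_of_notMem (by simpa using h), mul_zero]
      exact zero_le
  have hRpow : R ^ (2 * p - 2) = (c * y) ^ (p - 1) := by
    rw [hR, Real.sqrt_eq_rpow, ← Real.rpow_mul (by positivity)]
    ring_nf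
  calc ∫⁻ τ in Set.Ioi 0, ENNReal.ofReal (τ ^ (2 * p - 3)) * aboveLevel (τ ^ 2 / c) y
      ≤ ∫⁻ τ, (Set.Ioc 0 R).indicator f τ :=
        (setLIntegral_mono' measurableSet_Ioi hpoint).trans (setLIntegral_le_lintegral _ _)
    _ = ENNReal.ofReal ((c * y) ^ (p - 1) / (2 * p - 2)) * ENNReal.ofReal y := by
        rw [lintegral_indicator measurableSet_Ioc,
          lintegral_mul_const' _ _ ENNReal.ofReal_ne_top,
          setLIntegral_Ioc_ofReal_rpow (by linarith) (Real.sqrt_nonneg _),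
          show 2 * p - 3 + 1 = 2 * p - 2 by ring, hRpow]
    _ = ENNReal.ofReal (c ^ (p - 1) / (2 * p - 2)) * ENNReal.ofReal y ^ p := by
        have hp2 : 0 ≤ 2 * p - 2 := by linarith
        rw [ENNReal.ofReal_rpow_of_nonneg hy (by linarith), ← ENNReal.ofReal_mul (by positivity),
          ← ENNReal.ofReal_mul (by positivity), Real.mul_rpow hc.le hy]
        congr 1
        rcases hy.eq_or_lt with rfl | hy'
        · simp [Real.zero_rpow (by linarith : p ≠ 0)]
        · rw [Real.rpow_sub_one hy'.ne']
          field_simp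

variable {E F : Type*} [NormedAddCommGroup E] [NormedSpace ℝ E] [FiniteDimensional ℝ E]
  [MeasurableSpace E] [BorelSpace E] {μ : Measure E} [μ.IsAddHaarMeasure]
  [NormedAddCommGroup F] [NormedSpace ℝ F] {w : E → ℝ} {b : E → F} {W s ε : ℝ}

theorem enorm_dilate_convolution_le_aboveLevel (hw : Integrable w μ)
    (hW : eLpNorm w 1 μ ≤ ENNReal.ofReal W) {r t : ℝ} (hr : 0 ≤ r) (ht : 0 < t) (z : E) :
    ‖(dilate t w ⋆[ContinuousLinearMap.lsmul ℝ ℝ, μ] b) z‖ₑ ≤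
      ENNReal.ofReal (r * W) + ∫⁻ y, ‖dilate t w y‖ₑ * aboveLevel r ‖b (z - y)‖ ∂μ := by
  have hwt : AEMeasurable (fun y => ‖dilate t w y‖ₑ) μ :=
    (integrable_dilate hw ht.ne').aestronglyMeasurable.enorm
  calc ‖(dilate t w ⋆[ContinuousLinearMap.lsmul ℝ ℝ, μ] b) z‖ₑ
      ≤ ∫⁻ y, ‖dilate t w y‖ₑ * ‖b (z - y)‖ₑ ∂μ := by
        refine (enorm_integral_le_lintegral_enorm _).trans (lintegral_mono fun y => ?_)
        simp only [ContinuousLinearMap.lsmul_apply, enorm_smul, le_refl]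
    _ ≤ ∫⁻ y, (‖dilate t w y‖ₑ * ENNReal.ofReal r +
          ‖dilate t w y‖ₑ * aboveLevel r ‖b (z - y)‖) ∂μ := by
        refine lintegral_mono fun y => ?_
        rw [← mul_add, ← ofReal_norm (b (z - y))]
        gcongr
        exact ofReal_le_add_aboveLevel r _
    _ = eLpNorm w 1 μ * ENNReal.ofReal r +
          ∫⁻ y, ‖dilate t w y‖ₑ * aboveLevel r ‖b (z - y)‖ ∂μ := by
        rw [lintegral_add_left' (hwt.mul_const _), lintegral_mul_const'' _ hwt,
          ← eLpNorm_one_eq_lintegral_enorm, eLpNorm_one_dilate w ht]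
    _ ≤ ENNReal.ofReal (r * W) + ∫⁻ y, ‖dilate t w y‖ₑ * aboveLevel r ‖b (z - y)‖ ∂μ := by
        rw [ENNReal.ofReal_mul hr, mul_comm (ENNReal.ofReal r)]
        gcongr

theorem sum_dyadic_mul_enorm_convolution_lt_le (hw : Integrable w μ) (hW0 : 0 ≤ W)
    (hW : eLpNorm w 1 μ ≤ ENNReal.ofReal W) (hε : 0 < ε) {r T : ℝ} (hr : 0 ≤ r) (hT : 0 < T)
    (n : ℕ) (z : E) :
    ∑ k ∈ Finset.range n with ε * 2 ^ k < T, ENNReal.ofReal (ε * 2 ^ k) *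
        ‖(dilate (ε * 2 ^ k) w ⋆[ContinuousLinearMap.lsmul ℝ ℝ, μ] b) z‖ₑ ≤
      ENNReal.ofReal (2 * T * (r * W)) +
        ∑ k ∈ Finset.range n with ε * 2 ^ k < T, ENNReal.ofReal (ε * 2 ^ k) *
          ∫⁻ y, ‖dilate (ε * 2 ^ k) w y‖ₑ * aboveLevel r ‖b (z - y)‖ ∂μ := by
  calc _ ≤ ∑ k ∈ Finset.range n with ε * 2 ^ k < T, (ENNReal.ofReal (ε * 2 ^ k * (r * W)) +
        ENNReal.ofReal (ε * 2 ^ k) *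
          ∫⁻ y, ‖dilate (ε * 2 ^ k) w y‖ₑ * aboveLevel r ‖b (z - y)‖ ∂μ) := by
        refine Finset.sum_le_sum fun k _ => ?_
        have ht : 0 < ε * 2 ^ k := by positivity
        rw [ENNReal.ofReal_mul ht.le, ← mul_add]
        gcongr
        exact enorm_dilate_convolution_le_aboveLevel hw hW hr ht z
    _ ≤ _ := by
        rw [Finset.sum_add_distrib, ← ENNReal.ofReal_sum_of_nonneg fun k _ => by positivity,
          ← Finset.sum_mul]
        gcongr
        exact sum_dyadic_lt_le hε hT n

omit [NormedSpace ℝ F] in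
theorem aemeasurable_lintegral_dilate_mul_aboveLevel (hw : Integrable w μ)
    (hb : AEStronglyMeasurable b μ) {t : ℝ} (ht : 0 < t) (r : ℝ) :
    AEMeasurable (fun z => ∫⁻ y, ‖dilate t w y‖ₑ * aboveLevel r ‖b (z - y)‖ ∂μ) μ := by
  have habove : AEMeasurable (fun x => aboveLevel r ‖b x‖) μ :=
    (measurable_aboveLevel.comp measurable_prodMk_left).comp_aemeasurable hb.norm.aemeasurable
  exact ((integrable_dilate hw ht.ne').aestronglyMeasurable.enorm.comp_snd.mul
    (habove.comp_quasiMeasurePreserving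
      (quasiMeasurePreserving_sub_of_right_invariant μ μ))).lintegral_prod_right'

omit [NormedSpace ℝ F] in
theorem lintegral_sum_dyadic_mul_aboveLevel_le (hw : Integrable w μ)
    (hW : eLpNorm w 1 μ ≤ ENNReal.ofReal W) (hb : AEStronglyMeasurable b μ) (hε : 0 < ε) (r : ℝ)
    {T : ℝ} (hT : 0 < T) (n : ℕ) :
    ∫⁻ z, ∑ k ∈ Finset.range n with ε * 2 ^ k < T, ENNReal.ofReal (ε * 2 ^ k) *
        ∫⁻ y, ‖dilate (ε * 2 ^ k) w y‖ₑ * aboveLevel r ‖b (z - y)‖ ∂μ ∂μ ≤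
      ENNReal.ofReal (2 * T * W) * ∫⁻ x, aboveLevel r ‖b x‖ ∂μ := by
  have habove : AEMeasurable (fun x => aboveLevel r ‖b x‖) μ :=
    (measurable_aboveLevel.comp measurable_prodMk_left).comp_aemeasurable hb.norm.aemeasurable
  rw [lintegral_finsetSum' _ fun k _ => (aemeasurable_lintegral_dilate_mul_aboveLevel hw hb
    (by positivity) r).const_mul _]
  calc _ = (∑ k ∈ Finset.range n with ε * 2 ^ k < T, ENNReal.ofReal (ε * 2 ^ k)) *
        (eLpNorm w 1 μ * ∫⁻ x, aboveLevel r ‖b x‖ ∂μ) := by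
        rw [Finset.sum_mul]
        refine Finset.sum_congr rfl fun k _ => ?_
        have ht : 0 < ε * 2 ^ k := by positivity
        rw [lintegral_const_mul' _ _ ENNReal.ofReal_ne_top,
          lintegral_lintegral_mul_sub
            (integrable_dilate hw ht.ne').aestronglyMeasurable.enorm habove,
          ← eLpNorm_one_eq_lintegral_enorm, eLpNorm_one_dilate w ht]
    _ ≤ _ := by
        rw [← ENNReal.ofReal_sum_of_nonneg fun k _ => by positivity, ← mul_assoc,
          ENNReal.ofReal_mul (by positivity)]
        gcongr
        exact sum_dyadic_lt_le hε hT n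

/-- The scales above `4 * s / τ` contribute at most `τ / 2` to the sum, by the hypothesis `h`; in
the remaining ones the values of `b` below the level `τ ^ 2 / (32 * W * s)` contribute at most
`τ / 4`. -/
theorem ofReal_div_four_le_of_lt_sum_dyadic_mul (hw : Integrable w μ) (hW0 : 0 < W)
    (hW : eLpNorm w 1 μ ≤ ENNReal.ofReal W) (hs : 0 < s)
    (h : ∀ t, 0 < t → ∀ z,
      t ^ 2 * ‖(dilate t w ⋆[ContinuousLinearMap.lsmul ℝ ℝ, μ] b) z‖ ≤ s)
    (hε : 0 < ε) (n : ℕ) {τ : ℝ} (hτ : 0 < τ) {z : E}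
    (hz : τ < ∑ k ∈ Finset.range n, ε * 2 ^ k *
      ‖(dilate (ε * 2 ^ k) w ⋆[ContinuousLinearMap.lsmul ℝ ℝ, μ] b) z‖) :
    ENNReal.ofReal (τ / 4) ≤
      ∑ k ∈ Finset.range n with ε * 2 ^ k < 4 * s / τ, ENNReal.ofReal (ε * 2 ^ k) *
        ∫⁻ y, ‖dilate (ε * 2 ^ k) w y‖ₑ * aboveLevel (τ ^ 2 / (32 * W * s)) ‖b (z - y)‖ ∂μ := by
  set r := τ ^ 2 / (32 * W * s) with hr
  set T := 4 * s / τ with hT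
  have hT0 : 0 < T := by positivity
  have hlarge := sum_dyadic_mul_ge_le hs.le (fun t ht => h t ht z) hε hT0 n
  have hsmall := sum_dyadic_mul_enorm_convolution_lt_le (b := b) hw hW0.le hW hε
    (show 0 ≤ r by positivity) hT0 n z
  rw [show 2 * s / T = τ / 2 by rw [hT]; field_simp; ring] at hlarge
  rw [show 2 * T * (r * W) = τ / 4 by rw [hT, hr]; field_simp; ring] at hsmall
  rw [← Finset.sum_filter_add_sum_filter_not _ (fun k => ε * 2 ^ k < T)] at hz
  refine (ENNReal.add_le_add_iff_left (ENNReal.ofReal_ne_top (r := τ / 4))).1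
    (le_trans ?_ hsmall)
  calc ENNReal.ofReal (τ / 4) + ENNReal.ofReal (τ / 4) = ENNReal.ofReal (τ / 2) := by
        rw [← ENNReal.ofReal_add (by positivity) (by positivity)]
        congr 1
        ring
    _ ≤ ENNReal.ofReal (∑ k ∈ Finset.range n with ε * 2 ^ k < T, ε * 2 ^ k *
          ‖(dilate (ε * 2 ^ k) w ⋆[ContinuousLinearMap.lsmul ℝ ℝ, μ] b) z‖) :=
        ENNReal.ofReal_le_ofReal (by linarith)
    _ = ∑ k ∈ Finset.range n with ε * 2 ^ k < T, ENNReal.ofReal (ε * 2 ^ k) *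
          ‖(dilate (ε * 2 ^ k) w ⋆[ContinuousLinearMap.lsmul ℝ ℝ, μ] b) z‖ₑ := by
        rw [ENNReal.ofReal_sum_of_nonneg fun k _ => by positivity]
        refine Finset.sum_congr rfl fun k _ => ?_
        rw [ENNReal.ofReal_mul (by positivity), ofReal_norm]

theorem measure_lt_sum_dyadic_mul_le (hw : Integrable w μ) (hW0 : 0 < W)
    (hW : eLpNorm w 1 μ ≤ ENNReal.ofReal W) (hb : AEStronglyMeasurable b μ) (hs : 0 < s)
    (h : ∀ t, 0 < t → ∀ z,
      t ^ 2 * ‖(dilate t w ⋆[ContinuousLinearMap.lsmul ℝ ℝ, μ] b) z‖ ≤ s)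
    (hε : 0 < ε) (n : ℕ) {τ : ℝ} (hτ : 0 < τ) :
    μ {z | τ < ∑ k ∈ Finset.range n, ε * 2 ^ k *
        ‖(dilate (ε * 2 ^ k) w ⋆[ContinuousLinearMap.lsmul ℝ ℝ, μ] b) z‖} *
      ENNReal.ofReal (τ ^ 2) ≤
      ENNReal.ofReal (32 * W * s) * ∫⁻ x, aboveLevel (τ ^ 2 / (32 * W * s)) ‖b x‖ ∂μ := by
  set r := τ ^ 2 / (32 * W * s)
  set T := 4 * s / τ with hT
  have hT0 : 0 < T := by positivity
  set S : E → ℝ≥0∞ := fun z => ∑ k ∈ Finset.range n with ε * 2 ^ k < T, ENNReal.ofReal (ε * 2 ^ k) *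
    ∫⁻ y, ‖dilate (ε * 2 ^ k) w y‖ₑ * aboveLevel r ‖b (z - y)‖ ∂μ
  have hS : AEMeasurable S μ := Finset.aemeasurable_fun_sum _ fun k _ =>
    (aemeasurable_lintegral_dilate_mul_aboveLevel hw hb (by positivity) r).const_mul _
  calc _ ≤ (∫⁻ z, S z ∂μ) / ENNReal.ofReal (τ / 4) * ENNReal.ofReal (τ ^ 2) := by
        gcongr
        exact (measure_mono fun z hz =>
          ofReal_div_four_le_of_lt_sum_dyadic_mul hw hW0 hW hs h hε n hτ hz).trans
          (meas_ge_le_lintegral_div hS (ENNReal.ofReal_pos.2 (by positivity)).ne'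
            ENNReal.ofReal_ne_top)
    _ ≤ ENNReal.ofReal (2 * T * W) * (∫⁻ x, aboveLevel r ‖b x‖ ∂μ) / ENNReal.ofReal (τ / 4) *
          ENNReal.ofReal (τ ^ 2) := by
        gcongr
        exact lintegral_sum_dyadic_mul_aboveLevel_le hw hW hb hε r hT0 n
    _ = ENNReal.ofReal (2 * T * W * (τ / 4)⁻¹ * τ ^ 2) * ∫⁻ x, aboveLevel r ‖b x‖ ∂μ := by
        rw [ENNReal.ofReal_mul (p := 2 * T * W * (τ / 4)⁻¹) (by positivity),
          ENNReal.ofReal_mul (p := 2 * T * W) (by positivity),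
          ENNReal.ofReal_inv_of_pos (by positivity), div_eq_mul_inv]
        ring
    _ = ENNReal.ofReal (32 * W * s) * ∫⁻ x, aboveLevel r ‖b x‖ ∂μ := by
        congr 2
        rw [hT]
        field_simp
        ring

omit [BorelSpace E] [NormedSpace ℝ F] in
theorem lintegral_lintegral_aboveLevel_le (hb : AEStronglyMeasurable b μ) {p c : ℝ} (hp : 1 < p)
    (hc : 0 < c) :
    ∫⁻ τ in Set.Ioi 0, ENNReal.ofReal (τ ^ (2 * p - 3)) *
        ∫⁻ x, aboveLevel (τ ^ 2 / c) ‖b x‖ ∂μ ≤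
      ENNReal.ofReal (c ^ (p - 1) / (2 * p - 2)) * ∫⁻ x, ‖b x‖ₑ ^ p ∂μ := by
  have hjoint : AEMeasurable (fun q : ℝ × E =>
      ENNReal.ofReal (q.1 ^ (2 * p - 3)) * aboveLevel (q.1 ^ 2 / c) ‖b q.2‖)
      ((volume.restrict (Set.Ioi 0)).prod μ) :=
    (by fun_prop : Measurable fun q : ℝ × E => ENNReal.ofReal (q.1 ^ (2 * p - 3))).aemeasurable.mul
      (measurable_aboveLevel.comp_aemeasurable
        ((by fun_prop : Measurable fun q : ℝ × E => q.1 ^ 2 / c).aemeasurable.prodMk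
          hb.norm.aemeasurable.comp_snd))
  simp only [← lintegral_const_mul' _ _ ENNReal.ofReal_ne_top]
  rw [lintegral_lintegral_swap hjoint]
  refine lintegral_mono fun x => ?_
  rw [← ofReal_norm]
  exact lintegral_rpow_mul_aboveLevel_le hp hc (norm_nonneg _)

omit [BorelSpace E] [NormedSpace ℝ F] in
theorem lintegral_ofReal_rpow_le_of_forall_meas_lt_le {u : E → ℝ} (hu : AEMeasurable u μ)
    (hu0 : ∀ z, 0 ≤ u z) (hb : AEStronglyMeasurable b μ) {c : ℝ} (hc : 0 < c)
    (h : ∀ τ, 0 < τ → μ {z | τ < u z} * ENNReal.ofReal (τ ^ 2) ≤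
      ENNReal.ofReal c * ∫⁻ x, aboveLevel (τ ^ 2 / c) ‖b x‖ ∂μ) {p : ℝ} (hp : 1 < p) :
    ∫⁻ z, ENNReal.ofReal (u z ^ (2 * p)) ∂μ ≤
      ENNReal.ofReal (p / (p - 1) * c ^ p) * ∫⁻ x, ‖b x‖ₑ ^ p ∂μ := by
  have : 0 < p := by linarith
  calc ∫⁻ z, ENNReal.ofReal (u z ^ (2 * p)) ∂μ
      = ENNReal.ofReal (2 * p) * ∫⁻ τ in Set.Ioi 0,
          μ {z | τ < u z} * ENNReal.ofReal (τ ^ (2 * p - 1)) :=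
        lintegral_rpow_eq_lintegral_meas_lt_mul μ (ae_of_all _ hu0) hu (by positivity)
    _ ≤ ENNReal.ofReal (2 * p) * ∫⁻ τ in Set.Ioi 0, ENNReal.ofReal c *
          (ENNReal.ofReal (τ ^ (2 * p - 3)) * ∫⁻ x, aboveLevel (τ ^ 2 / c) ‖b x‖ ∂μ) := by
        gcongr ENNReal.ofReal (2 * p) * ?_
        refine setLIntegral_mono' measurableSet_Ioi fun τ (hτ : 0 < τ) => ?_
        rw [show 2 * p - 1 = 2 + (2 * p - 3) by ring, Real.rpow_add hτ, Real.rpow_two,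
          ENNReal.ofReal_mul (by positivity), ← mul_assoc, mul_left_comm, mul_comm]
        gcongr _ * ?_
        exact h τ hτ
    _ ≤ ENNReal.ofReal (2 * p) * (ENNReal.ofReal c *
          (ENNReal.ofReal (c ^ (p - 1) / (2 * p - 2)) * ∫⁻ x, ‖b x‖ₑ ^ p ∂μ)) := by
        rw [lintegral_const_mul' _ _ ENNReal.ofReal_ne_top]
        gcongr
        exact lintegral_lintegral_aboveLevel_le hb hp hc
    _ = ENNReal.ofReal (p / (p - 1) * c ^ p) * ∫⁻ x, ‖b x‖ₑ ^ p ∂μ := by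
        rw [← mul_assoc, ← mul_assoc, ← ENNReal.ofReal_mul (by positivity),
          ← ENNReal.ofReal_mul (by positivity)]
        congr 2
        have hp1 : p - 1 ≠ 0 := by linarith
        rw [show 2 * p - 2 = 2 * (p - 1) by ring, Real.rpow_sub_one hc.ne']
        field_simp

theorem lintegral_sum_dyadic_smul_convolution_rpow_le (hw : Continuous w)
    (hw_supp : HasCompactSupport w) (hW0 : 0 < W) (hW : eLpNorm w 1 μ ≤ ENNReal.ofReal W)
    (hb : LocallyIntegrable b μ) (hs : 0 < s)
    (h : ∀ t, 0 < t → ∀ z,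
      t ^ 2 * ‖(dilate t w ⋆[ContinuousLinearMap.lsmul ℝ ℝ, μ] b) z‖ ≤ s)
    (hε : 0 < ε) (n : ℕ) {p : ℝ} (hp : 1 < p) :
    ∫⁻ z, ‖∑ k ∈ Finset.range n, (ε * 2 ^ k) •
        (dilate (ε * 2 ^ k) w ⋆[ContinuousLinearMap.lsmul ℝ ℝ, μ] b) z‖ₑ ^ (2 * p) ∂μ ≤
      ENNReal.ofReal (p / (p - 1) * (32 * W * s) ^ p) * ∫⁻ x, ‖b x‖ₑ ^ p ∂μ := by
  have hwi : Integrable w μ := hw.integrable_of_hasCompactSupport hw_supp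
  have hpos (k : ℕ) : 0 < ε * 2 ^ k := by positivity
  set u : E → ℝ := fun z => ∑ k ∈ Finset.range n, ε * 2 ^ k *
    ‖(dilate (ε * 2 ^ k) w ⋆[ContinuousLinearMap.lsmul ℝ ℝ, μ] b) z‖
  have hu0 (z : E) : 0 ≤ u z := Finset.sum_nonneg fun k _ => by positivity
  have hu : Continuous u := continuous_finsetSum _ fun k _ => continuous_const.mul
    (continuous_dilate_convolution hw hw_supp hb (hpos k).ne').norm
  calc _ ≤ ∫⁻ z, ENNReal.ofReal (u z ^ (2 * p)) ∂μ := by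
        refine lintegral_mono fun z => ?_
        rw [← ENNReal.ofReal_rpow_of_nonneg (hu0 z) (by positivity), ← ofReal_norm]
        gcongr
        refine (norm_sum_le _ _).trans_eq (Finset.sum_congr rfl fun k _ => ?_)
        rw [norm_smul, Real.norm_of_nonneg (hpos k).le]
    _ ≤ ENNReal.ofReal (p / (p - 1) * (32 * W * s) ^ p) * ∫⁻ x, ‖b x‖ₑ ^ p ∂μ :=
        lintegral_ofReal_rpow_le_of_forall_meas_lt_le hu.measurable.aemeasurable hu0
          hb.aestronglyMeasurable (by positivity)
          (fun _ => measure_lt_sum_dyadic_mul_le hwi hW0 hW hb.aestronglyMeasurable hs h hε n) hp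

theorem eLpNorm_sum_dyadic_smul_convolution_le {ε s W : ℝ} {w : E → ℝ} {b : E → F}
    (hw : Continuous w) (hw_supp : HasCompactSupport w) (hW0 : 0 < W)
    (hW : eLpNorm w 1 μ ≤ ENNReal.ofReal W) (hb : LocallyIntegrable b μ) (hs : 0 < s)
    (h : ∀ t, 0 < t → ∀ z,
      t ^ 2 * ‖(dilate t w ⋆[ContinuousLinearMap.lsmul ℝ ℝ, μ] b) z‖ ≤ s)
    (hε : 0 < ε) (n : ℕ) {p : ℝ≥0∞} (hp : 1 < p) (hp' : p ≠ ⊤) :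
    eLpNorm (∑ k ∈ Finset.range n, (ε * 2 ^ k) •
        (dilate (ε * 2 ^ k) w ⋆[ContinuousLinearMap.lsmul ℝ ℝ, μ] b)) (2 * p) μ ≤
      ENNReal.ofReal (p.toReal / (p.toReal - 1)) ^ (1 / (2 * p.toReal)) *
        (ENNReal.ofReal (32 * W * s) * eLpNorm b p μ) ^ (1 / 2 : ℝ) := by
  have hr : 1 < p.toReal := by simpa using ENNReal.toReal_strict_mono hp' hp
  have hp0 : p ≠ 0 := (zero_lt_one.trans hp).ne'
  rw [eLpNorm_eq_lintegral_rpow_enorm_toReal (by positivity) (by finiteness),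
    eLpNorm_eq_lintegral_rpow_enorm_toReal hp0 hp', ENNReal.toReal_mul, ENNReal.toReal_ofNat]
  set r := p.toReal
  have hr0 : 0 < r := by positivity
  calc _ ≤ (ENNReal.ofReal (r / (r - 1) * (32 * W * s) ^ r) *
          ∫⁻ x, ‖b x‖ₑ ^ r ∂μ) ^ (1 / (2 * r)) := by
        gcongr
        simpa only [Finset.sum_apply, Pi.smul_apply] using
          lintegral_sum_dyadic_smul_convolution_rpow_le hw hw_supp hW0 hW hb hs h hε n hr
    _ = ENNReal.ofReal (r / (r - 1)) ^ (1 / (2 * r)) *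
          ((ENNReal.ofReal (32 * W * s) ^ r * ∫⁻ x, ‖b x‖ₑ ^ r ∂μ) ^ (1 / r)) ^ (1 / 2 : ℝ) := by
        rw [ENNReal.ofReal_mul (div_nonneg hr0.le (sub_nonneg.2 hr.le)), mul_assoc,
          ENNReal.mul_rpow_of_nonneg _ _ (by positivity), ← ENNReal.rpow_mul,
          ENNReal.ofReal_rpow_of_nonneg (by positivity) hr0.le, one_div_mul_one_div, mul_comm r]
    _ = _ := by
        rw [ENNReal.mul_rpow_of_nonneg _ _ (by positivity : 0 ≤ 1 / r), ← ENNReal.rpow_mul,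
          mul_one_div_cancel hr0.ne', ENNReal.rpow_one]

end PotentialEstimate

/-! ### A kernel whose divergence telescopes -/

section PartialDeriv

theorem partialDeriv_sub {f g : E3 → ℝ} (hf : Differentiable ℝ f) (hg : Differentiable ℝ g)
    (i : Fin 3) : partialDeriv i (f - g) = partialDeriv i f - partialDeriv i g := by
  ext x
  simp only [partialDeriv, Pi.sub_apply, fderiv_sub (hf x) (hg x), sub_apply]

theorem partialDeriv_const_smul (c : ℝ) (f : E3 → ℝ) (i : Fin 3) :
    partialDeriv i (c • f) = c • partialDeriv i f := by
  ext x
  simp only [partialDeriv, Pi.smul_apply, fderiv_const_smul_field, smul_apply]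

theorem partialDeriv_sum {ι : Type*} (s : Finset ι) {f : ι → E3 → ℝ}
    (hf : ∀ k ∈ s, Differentiable ℝ (f k)) (i : Fin 3) :
    partialDeriv i (∑ k ∈ s, f k) = ∑ k ∈ s, partialDeriv i (f k) := by
  ext x
  simp only [partialDeriv, Finset.sum_apply, fderiv_sum fun k hk => hf k hk x,
    sum_apply]

theorem partialDeriv_comp_smul (c : ℝ) (f : E3 → ℝ) (i : Fin 3) (x : E3) :
    partialDeriv i (fun y => f (c • y)) x = c * partialDeriv i f (c • x) := by
  rw [partialDeriv, fderiv_comp_smul]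
  rfl

theorem partialDeriv_dilate (t : ℝ) (f : E3 → ℝ) (i : Fin 3) :
    partialDeriv i (dilate t f) = t⁻¹ • dilate t (partialDeriv i f) := by
  ext x
  change partialDeriv i ((t ^ Module.finrank ℝ E3)⁻¹ • fun y => f (t⁻¹ • y)) x = _
  rw [partialDeriv_const_smul, Pi.smul_apply, partialDeriv_comp_smul, Pi.smul_apply, smul_eq_mul,
    smul_eq_mul, mul_left_comm, dilate]

theorem contDiff_partialDeriv {f : E3 → ℝ} (hf : ContDiff ℝ ∞ f) (i : Fin 3) :
    ContDiff ℝ ∞ (partialDeriv i f) :=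
  (hf.fderiv_right (m := ∞) (by simp)).clm_apply contDiff_const

end PartialDeriv

section Kernel

/-- The radial profile `s ↦ s ^ (-3 / 2)`, cut off smoothly near `0`: the field
`x ↦ newtonProfile (‖x‖ ^ 2) • x` is the Newtonian field `x / ‖x‖ ^ 3` away from the origin. -/
noncomputable def newtonProfile (s : ℝ) : ℝ :=
  Real.smoothTransition (s - 1) * s ^ (-3 / 2 : ℝ)

theorem contDiff_newtonProfile : ContDiff ℝ ∞ newtonProfile := by
  refine contDiff_iff_contDiffAt.2 fun s => ?_
  rcases lt_or_ge s 1 with hs | hs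
  · have hzero : newtonProfile =ᶠ[𝓝 s] 0 := by
      filter_upwards [Iio_mem_nhds hs] with r (hr : r < 1)
      rw [newtonProfile, Real.smoothTransition.zero_of_nonpos (by linarith), zero_mul,
        Pi.zero_apply]
    exact contDiffAt_const.congr_of_eventuallyEq hzero
  · exact (Real.smoothTransition.contDiffAt.comp s (contDiffAt_id.sub contDiffAt_const)).mul
      (contDiffAt_id.rpow_const_of_ne (zero_lt_one.trans_le hs).ne')

theorem three_mul_newtonProfile_add {s : ℝ} (hs : 0 ≤ s) :
    3 * newtonProfile s + 2 * s * deriv newtonProfile s =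
      2 * deriv Real.smoothTransition (s - 1) * s ^ (-1 / 2 : ℝ) := by
  rcases hs.eq_or_lt with rfl | hs'
  · norm_num [newtonProfile]
  have hθ : HasDerivAt (fun s => Real.smoothTransition (s - 1))
      (deriv Real.smoothTransition (s - 1)) s :=
    ((Real.smoothTransition.contDiff (n := 1).differentiable (by simp)
      _).hasDerivAt).comp_sub_const s 1
  have hderiv : HasDerivAt newtonProfile _ s :=
    hθ.mul (Real.hasDerivAt_rpow_const (p := -3 / 2) (Or.inl hs'.ne'))
  rw [hderiv.deriv, newtonProfile]
  have h1 : s ^ (-1 / 2 : ℝ) = s ^ (-3 / 2 : ℝ) * s := by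
    rw [← Real.rpow_add_one hs'.ne']; norm_num
  have h2 : s ^ (-3 / 2 : ℝ) = s ^ (-3 / 2 - 1 : ℝ) * s := by
    rw [← Real.rpow_add_one hs'.ne']; norm_num
  rw [h1, h2]
  ring

/-- The `i`-th component of the field `x ↦ x / ‖x‖ ^ 3`, cut off smoothly near the origin. -/
noncomputable def newtonField (i : Fin 3) (x : E3) : ℝ :=
  x i * newtonProfile (‖x‖ ^ 2)

/-- The divergence of `newtonField`. It is a bump, because `x / ‖x‖ ^ 3` is divergence free. -/
noncomputable def newtonDiv : E3 → ℝ :=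
  ∑ i, partialDeriv i (newtonField i)

theorem contDiff_newtonField (i : Fin 3) : ContDiff ℝ ∞ (newtonField i) :=
  (EuclideanSpace.proj (𝕜 := ℝ) i : E3 →L[ℝ] ℝ).contDiff.mul
    (contDiff_newtonProfile.comp (contDiff_norm_sq ℝ))

theorem newtonField_eq_of_two_le {x : E3} (hx : 2 ≤ ‖x‖ ^ 2) (i : Fin 3) :
    newtonField i x = x i * (‖x‖ ^ 3)⁻¹ := by
  rw [newtonField, newtonProfile, Real.smoothTransition.one_of_one_le (by linarith), one_mul,
    ← Real.rpow_natCast_mul (norm_nonneg x), ← Real.rpow_natCast, ← Real.rpow_neg (norm_nonneg x)]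
  norm_num

theorem partialDeriv_newtonField (i : Fin 3) (x : E3) :
    partialDeriv i (newtonField i) x =
      newtonProfile (‖x‖ ^ 2) + 2 * x i ^ 2 * deriv newtonProfile (‖x‖ ^ 2) := by
  have hcoord : HasFDerivAt (fun x : E3 => x i) (EuclideanSpace.proj (𝕜 := ℝ) i : E3 →L[ℝ] ℝ) x :=
    (EuclideanSpace.proj (𝕜 := ℝ) i : E3 →L[ℝ] ℝ).hasFDerivAt
  have hderiv : HasDerivAt newtonProfile _ (‖x‖ ^ 2) :=
    (contDiff_newtonProfile.differentiable (by simp) (‖x‖ ^ 2)).hasDerivAt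
  have hprofile : HasFDerivAt (newtonProfile ∘ fun x : E3 => ‖x‖ ^ 2) _ x :=
    HasDerivAt.comp_hasFDerivAt (h₂ := newtonProfile) x hderiv
      (hasStrictFDerivAt_norm_sq x).hasFDerivAt
  have hfield : HasFDerivAt (newtonField i) _ x := hcoord.mul hprofile
  have hinner : innerSL ℝ x (EuclideanSpace.single i 1) = x i := by
    change inner ℝ x (EuclideanSpace.single i (1 : ℝ)) = x i
    simp [EuclideanSpace.inner_single_right]
  rw [partialDeriv, hfield.fderiv]
  simp only [add_apply, smul_apply, hinner, smul_eq_mul, nsmul_eq_mul, Nat.cast_ofNat,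
    PiLp.proj_apply, PiLp.single_apply, if_true]
  ring

theorem newtonDiv_apply (x : E3) :
    newtonDiv x = 2 * deriv Real.smoothTransition (‖x‖ ^ 2 - 1) * (‖x‖ ^ 2) ^ (-1 / 2 : ℝ) := by
  simp only [newtonDiv, Finset.sum_apply, partialDeriv_newtonField]
  rw [← three_mul_newtonProfile_add (sq_nonneg _), Finset.sum_add_distrib, ← Finset.sum_mul,
    ← Finset.mul_sum, ← EuclideanSpace.real_norm_sq_eq]
  simp

theorem continuous_newtonDiv : Continuous newtonDiv := by
  simpa only [newtonDiv, Finset.sum_fn] using continuous_finsetSum Finset.univ fun i _ =>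
    (contDiff_partialDeriv (contDiff_newtonField i) i).continuous

theorem newtonDiv_nonneg (x : E3) : 0 ≤ newtonDiv x := by
  have := Real.smoothTransition.monotone.deriv_nonneg (x := ‖x‖ ^ 2 - 1)
  rw [newtonDiv_apply]
  positivity

theorem hasCompactSupport_newtonDiv : HasCompactSupport newtonDiv := by
  refine HasCompactSupport.intro (isCompact_closedBall (0 : E3) 2) fun x hx => ?_
  have hx' : 2 < ‖x‖ := by simpa using hx
  have hconst : Real.smoothTransition =ᶠ[𝓝 (‖x‖ ^ 2 - 1)] fun _ => 1 := by
    filter_upwards [lt_mem_nhds (by nlinarith : 1 < ‖x‖ ^ 2 - 1)] with y hy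
    exact Real.smoothTransition.one_of_one_le hy.le
  rw [newtonDiv_apply, hconst.deriv_eq]
  simp

theorem integral_newtonDiv_pos : 0 < ∫ x, newtonDiv x := by
  obtain ⟨c, hc, hderiv⟩ := exists_deriv_eq_slope Real.smoothTransition zero_lt_one
    Real.smoothTransition.continuous.continuousOn
    (Real.smoothTransition.contDiff (n := 1).differentiable (by simp)).differentiableOn
  simp only [Real.smoothTransition.one, Real.smoothTransition.zero, sub_zero, div_one] at hderiv
  have hc0 : 0 < 1 + c := by linarith [hc.1]
  refine continuous_newtonDiv.integral_pos_of_hasCompactSupport_nonneg_nonzero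
    hasCompactSupport_newtonDiv newtonDiv_nonneg (x := EuclideanSpace.single 0 √(1 + c)) ?_
  rw [newtonDiv_apply, PiLp.norm_single, Real.norm_of_nonneg (Real.sqrt_nonneg _),
    Real.sq_sqrt hc0.le, add_sub_cancel_left, hderiv]
  positivity

/-- A probability density `ρ` on `ℝ³` together with a field `Ψ` of test functions such that
`∇ · Ψ` is the difference of `ρ` and its dilate by the factor `2`, so that the divergences of the
dilates of `Ψ` at dyadic scales telescope. -/
structure IsTelescoping (ρ : E3 → ℝ) (Ψ : Fin 3 → E3 → ℝ) : Prop where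
  continuous : Continuous ρ
  hasCompactSupport : HasCompactSupport ρ
  nonneg : ∀ x, 0 ≤ ρ x
  integral_eq_one : ∫ x, ρ x = 1
  isTestFunction : ∀ i, IsTestFunction (Ψ i)
  sum_partialDeriv : ∑ i, partialDeriv i (Ψ i) = ρ - dilate 2 ρ

theorem hasCompactSupport_newtonField_sub_dilate (i : Fin 3) :
    HasCompactSupport (newtonField i - (2 : ℝ) • dilate 2 (newtonField i)) := by
  refine HasCompactSupport.intro (isCompact_closedBall (0 : E3) 3) fun x hx => ?_
  have hx' : 3 < ‖x‖ := by simpa using hx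
  have hhalf : ‖(2 : ℝ)⁻¹ • x‖ = ‖x‖ / 2 := by
    rw [norm_smul, norm_inv, Real.norm_ofNat, inv_mul_eq_div]
  rw [Pi.sub_apply, Pi.smul_apply, dilate, newtonField_eq_of_two_le (by nlinarith),
    newtonField_eq_of_two_le (by rw [hhalf]; nlinarith), hhalf, finrank_euclideanSpace_fin]
  simp only [PiLp.smul_apply, smul_eq_mul]
  field_simp
  ring

theorem exists_isTelescoping : ∃ ρ Ψ, IsTelescoping ρ Ψ := by
  set c := (∫ x, newtonDiv x)⁻¹ with hc
  have hc0 : 0 < c := inv_pos.2 integral_newtonDiv_pos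
  have hdilate (i : Fin 3) : ContDiff ℝ ∞ ((2 : ℝ) • dilate 2 (newtonField i)) :=
    contDiff_const.smul (contDiff_dilate (contDiff_newtonField i) 2)
  have hdiv (i : Fin 3) :
      partialDeriv i (c • (newtonField i - (2 : ℝ) • dilate 2 (newtonField i))) =
        c • (partialDeriv i (newtonField i) - dilate 2 (partialDeriv i (newtonField i))) := by
    rw [partialDeriv_const_smul, partialDeriv_sub
      ((contDiff_newtonField i).differentiable (by simp)) ((hdilate i).differentiable (by simp)),
      partialDeriv_const_smul, partialDeriv_dilate, smul_inv_smul₀ two_ne_zero]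
  refine ⟨c • newtonDiv, fun i => c • (newtonField i - (2 : ℝ) • dilate 2 (newtonField i)),
    continuous_newtonDiv.const_smul c, hasCompactSupport_newtonDiv.mul_left,
    fun x => mul_nonneg hc0.le (newtonDiv_nonneg x), ?_, fun i => ⟨?_, ?_⟩, ?_⟩
  · simp only [Pi.smul_apply, smul_eq_mul]
    rw [integral_const_mul, hc, inv_mul_cancel₀ integral_newtonDiv_pos.ne']
  · exact contDiff_const.smul ((contDiff_newtonField i).sub (hdilate i))
  · exact (hasCompactSupport_newtonField_sub_dilate i).mul_left
  · simp only [hdiv]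
    rw [← Finset.smul_sum, Finset.sum_sub_distrib, ← dilate_sum, dilate_const_smul, ← smul_sub,
      newtonDiv]

end Kernel

/-! ### The homotopy formula for the curl -/

section Curl

open scoped Convolution

theorem IsTestFunction.partialDeriv {η : E3 → ℝ} (hη : IsTestFunction η) (i : Fin 3) :
    IsTestFunction (partialDeriv i η) := by
  refine ⟨contDiff_partialDeriv hη.1 i,
    (hη.2.fderiv (𝕜 := ℝ)).mono' fun x hx => subset_tsupport _ fun h0 => hx ?_⟩
  rw [_root_.partialDeriv, h0, zero_apply]

theorem IsTestFunction.comp_sub_left {η : E3 → ℝ} (hη : IsTestFunction η) (z : E3) :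
    IsTestFunction fun y => η (z - y) :=
  ⟨hη.1.comp (contDiff_const.sub contDiff_id), hη.2.comp_homeomorph (Homeomorph.subLeft z)⟩

theorem IsTestFunction.dilate {η : E3 → ℝ} (hη : IsTestFunction η) {t : ℝ} (ht : t ≠ 0) :
    IsTestFunction (dilate t η) :=
  ⟨contDiff_dilate hη.1 t, hasCompactSupport_dilate hη.2 ht⟩

theorem IsTestFunction.const_smul {η : E3 → ℝ} (hη : IsTestFunction η) (c : ℝ) :
    IsTestFunction (c • η) :=
  ⟨contDiff_const.smul hη.1, hη.2.mul_left⟩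

theorem IsTestFunction.sum {ι : Type*} (s : Finset ι) {η : ι → E3 → ℝ}
    (hη : ∀ i, IsTestFunction (η i)) : IsTestFunction (∑ i ∈ s, η i) :=
  Finset.sum_induction η IsTestFunction (fun _ _ h h' => ⟨h.1.add h'.1, h.2.add h'.2⟩)
    ⟨contDiff_const, HasCompactSupport.zero⟩ fun i _ => hη i

theorem IsTestFunction.memLp {η : E3 → ℝ} (hη : IsTestFunction η) {p : ℝ≥0∞} : MemLp η p :=
  hη.1.continuous.memLp_of_hasCompactSupport hη.2

theorem IsTestFunction.integrable {η : E3 → ℝ} (hη : IsTestFunction η) : Integrable η :=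
  memLp_one_iff_integrable.1 hη.memLp

theorem IsTestFunction.convolutionExists {η : E3 → ℝ} (hη : IsTestFunction η) {f : E3 → E3}
    (hf : LocallyIntegrable f) :
    ConvolutionExists η f (ContinuousLinearMap.lsmul ℝ ℝ) volume :=
  hη.2.convolutionExists_left _ hη.1.continuous hf

theorem IsTestFunction.contDiff_convolution {η : E3 → ℝ} (hη : IsTestFunction η) {f : E3 → E3}
    (hf : LocallyIntegrable f) : ContDiff ℝ ∞ (η ⋆ f) :=
  hη.2.contDiff_convolution_left _ hη.1 hf

theorem IsTestFunction.memLp_convolution {η : E3 → ℝ} (hη : IsTestFunction η) {f : E3 → E3}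
    {p : ℝ≥0∞} (hp : 1 ≤ p) (hp' : p ≠ ⊤) (hf : MemLp f p) : MemLp (η ⋆ f) p := by
  refine ⟨(hη.contDiff_convolution (hf.locallyIntegrable hp)).continuous.aestronglyMeasurable,
    (eLpNorm_convolution_le _ hη.integrable hf.1 hp hp').trans_lt ?_⟩
  have := hη.memLp (p := 1) |>.2
  have := hf.2
  finiteness

theorem IsTestFunction.integrable_comp_sub_left_smul {η : E3 → ℝ} (hη : IsTestFunction η)
    {f : E3 → E3} (hf : LocallyIntegrable f) (z : E3) :
    Integrable fun y => η (z - y) • f y :=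
  (hη.convolutionExists hf z).integrable_swap

theorem IsTestFunction.convolution_apply_apply {η : E3 → ℝ} (hη : IsTestFunction η) {f : E3 → E3}
    (hf : LocallyIntegrable f) (z : E3) (i : Fin 3) :
    (η ⋆ f) z i = ∫ y, η (z - y) * f y i := by
  rw [convolution_lsmul_swap]
  exact ((EuclideanSpace.proj (𝕜 := ℝ) i : E3 →L[ℝ] ℝ).integral_comp_comm
    (hη.integrable_comp_sub_left_smul hf z)).symm

theorem IsTestFunction.fderiv_convolution {η : E3 → ℝ} (hη : IsTestFunction η) {f : E3 → E3}
    (hf : LocallyIntegrable f) (z : E3) (i : Fin 3) :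
    fderiv ℝ (η ⋆ f) z (EuclideanSpace.single i 1) = (_root_.partialDeriv i η ⋆ f) z := by
  have hderiv := hη.2.hasFDerivAt_convolution_right (μ := volume)
    (ContinuousLinearMap.lsmul ℝ ℝ).flip hf (hη.1.of_le (by simp)) z
  rw [convolution_flip] at hderiv
  rw [hderiv.fderiv, convolution_precompR_apply _ hf (hη.2.fderiv (𝕜 := ℝ))
    (hη.1.continuous_fderiv (by simp)), convolution_flip]
  rfl

theorem partialDeriv_convolution_apply {η : E3 → ℝ} (hη : IsTestFunction η) {f : E3 → E3}
    (hf : LocallyIntegrable f) (z : E3) (i j : Fin 3) :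
    partialDeriv j (fun z => (η ⋆ f) z i) z = (partialDeriv j η ⋆ f) z i := by
  have hderiv := ((EuclideanSpace.proj (𝕜 := ℝ) i : E3 →L[ℝ] ℝ).hasFDerivAt.comp z
    ((hη.contDiff_convolution hf).differentiable (by simp) z).hasFDerivAt)
  rw [← hη.fderiv_convolution hf]
  exact congr($(hderiv.fderiv) (EuclideanSpace.single j 1))

theorem partialDeriv_comp_sub_left {η : E3 → ℝ} (hη : Differentiable ℝ η) (z y : E3)
    (i : Fin 3) : partialDeriv i (fun y => η (z - y)) y = -partialDeriv i η (z - y) := by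
  have hderiv : HasFDerivAt (fun y => η (z - y)) _ y :=
    (hη (z - y)).hasFDerivAt.comp y ((hasFDerivAt_id y).const_sub z)
  simp [partialDeriv, hderiv.fderiv]

theorem HasWeakCurl.convolution_apply {A B : E3 → E3} (h : HasWeakCurl A B) {η : E3 → ℝ}
    (hη : IsTestFunction η) (z : E3) (i : Fin 3) :
    (η ⋆ B) z i =
      (partialDeriv (i + 1) η ⋆ A) z (i + 2) - (partialDeriv (i + 2) η ⋆ A) z (i + 1) := by
  have hint (j k : Fin 3) : Integrable fun y => partialDeriv j η (z - y) * A y k :=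
    (EuclideanSpace.proj (𝕜 := ℝ) k : E3 →L[ℝ] ℝ).integrable_comp
      ((hη.partialDeriv j).integrable_comp_sub_left_smul h.1 z)
  rw [hη.convolution_apply_apply h.2.1, h.2.2 _ (hη.comp_sub_left z) i,
    (hη.partialDeriv _).convolution_apply_apply h.1,
    (hη.partialDeriv _).convolution_apply_apply h.1, ← integral_neg,
    ← integral_sub (hint _ _) (hint _ _)]
  simp only [partialDeriv_comp_sub_left (hη.1.differentiable (by simp)), neg_mul, neg_sub,
    neg_sub_neg]

theorem sum_convolution {ι : Type*} (s : Finset ι) {η : ι → E3 → ℝ} (hη : ∀ i, IsTestFunction (η i))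
    {f : E3 → E3} (hf : LocallyIntegrable f) :
    (∑ i ∈ s, η i) ⋆ f = ∑ i ∈ s, η i ⋆ f := by
  ext1 z
  simp only [convolution_lsmul_swap, Finset.sum_apply, Finset.sum_smul]
  exact integral_finsetSum _ fun i _ => (hη i).integrable_comp_sub_left_smul hf z

theorem gradient_apply {φ : E3 → ℝ} (x : E3) (i : Fin 3) : gradient φ x i = partialDeriv i φ x := by
  rw [partialDeriv, ← toDual_gradient, InnerProductSpace.toDual_apply_apply,
    EuclideanSpace.inner_single_right, one_mul]
  rfl

theorem hasWeakGradient_gradient {φ : E3 → ℝ} (hφ : ContDiff ℝ ∞ φ) :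
    HasWeakGradient φ (gradient φ) := by
  have hgrad : Continuous (gradient φ) :=
    (InnerProductSpace.toDual ℝ E3).symm.continuous.comp (hφ.continuous_fderiv (by simp))
  refine ⟨hφ.continuous.locallyIntegrable, hgrad.locallyIntegrable, fun η hη i => ?_⟩
  simp only [gradient_apply]
  refine integral_mul_fderiv_eq_neg_fderiv_mul_of_integrable ?_ ?_ ?_
    (fun x _ => hη.1.differentiable (by simp) x) fun x _ => hφ.differentiable (by simp) x
  · exact ((hη.partialDeriv i).1.continuous.mul hφ.continuous).integrable_of_hasCompactSupport
      (hη.partialDeriv i).2.mul_right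
  · exact (hη.1.continuous.mul
      (contDiff_partialDeriv hφ i).continuous).integrable_of_hasCompactSupport hη.2.mul_right
  · exact (hη.1.continuous.mul hφ.continuous).integrable_of_hasCompactSupport hη.2.mul_right

theorem modGradNorm_le_of_contDiff {A : E3 → E3} {φ : E3 → ℝ} (hφ : ContDiff ℝ ∞ φ)
    (hgrad : MemLp (gradient φ) 3) : modGradNorm A ≤ eLpNorm (A - gradient φ) 3 :=
  sInf_le ⟨φ, gradient φ, hasWeakGradient_gradient hφ, hgrad, rfl⟩

/-- The potential `∑ i, K i ⋆ A i`, whose gradient differs from `(∇ · K) ⋆ A` only by a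
convolution of `K` with the curl of `A`. -/
noncomputable def potential (K : Fin 3 → E3 → ℝ) (A : E3 → E3) (z : E3) : ℝ :=
  ∑ i, (K i ⋆ A) z i

theorem contDiff_potential {K : Fin 3 → E3 → ℝ} (hK : ∀ i, IsTestFunction (K i)) {A : E3 → E3}
    (hA : LocallyIntegrable A) : ContDiff ℝ ∞ (potential K A) :=
  ContDiff.sum fun i _ => (EuclideanSpace.proj (𝕜 := ℝ) i : E3 →L[ℝ] ℝ).contDiff.comp
    ((hK i).contDiff_convolution hA)

theorem gradient_potential_apply {K : Fin 3 → E3 → ℝ} (hK : ∀ i, IsTestFunction (K i))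
    {A : E3 → E3} (hA : LocallyIntegrable A) (z : E3) (j : Fin 3) :
    gradient (potential K A) z j = ∑ i, (partialDeriv j (K i) ⋆ A) z i := by
  have hdiff (i : Fin 3) : Differentiable ℝ fun z => (K i ⋆ A) z i :=
    (EuclideanSpace.proj (𝕜 := ℝ) i : E3 →L[ℝ] ℝ).differentiable.comp
      (((hK i).contDiff_convolution hA).differentiable (by simp))
  have hsum : potential K A = ∑ i, fun z => (K i ⋆ A) z i := by
    ext z
    rw [potential, Finset.sum_apply]
  rw [gradient_apply, hsum, partialDeriv_sum _ fun i _ => hdiff i, Finset.sum_apply]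
  exact Finset.sum_congr rfl fun i _ => partialDeriv_convolution_apply (hK i) hA z i j

theorem memLp_gradient_potential {K : Fin 3 → E3 → ℝ} (hK : ∀ i, IsTestFunction (K i))
    {A : E3 → E3} {p : ℝ≥0∞} (hp : 1 ≤ p) (hp' : p ≠ ⊤) (hA : MemLp A p) :
    MemLp (gradient (potential K A)) p := by
  refine (memLp_toLp_of_forall fun j => memLp_finsetSum Finset.univ fun i _ =>
    (EuclideanSpace.proj (𝕜 := ℝ) i : E3 →L[ℝ] ℝ).comp_memLp'
      (((hK i).partialDeriv j).memLp_convolution hp hp' hA)).ae_eq (ae_of_all _ fun z => ?_)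
  ext j
  rw [gradient_potential_apply hK (hA.locallyIntegrable hp)]
  simp

theorem gradient_potential_apply_eq {A B : E3 → E3} (h : HasWeakCurl A B) {K : Fin 3 → E3 → ℝ}
    (hK : ∀ i, IsTestFunction (K i)) (z : E3) (j : Fin 3) :
    gradient (potential K A) z j = ((∑ i, partialDeriv i (K i)) ⋆ A) z j -
      ((K (j + 2) ⋆ B) z (j + 1) - (K (j + 1) ⋆ B) z (j + 2)) := by
  rw [gradient_potential_apply hK h.1, sum_convolution _ (fun i => (hK i).partialDeriv i) h.1,
    h.convolution_apply (hK _), h.convolution_apply (hK _), Finset.sum_apply]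
  simp only [Fin.sum_univ_three, PiLp.add_apply]
  fin_cases j <;> simp <;> ring

theorem norm_le_sum_norm_apply {ι : Type*} [Fintype ι] (v : EuclideanSpace ℝ ι) :
    ‖v‖ ≤ ∑ i, ‖v i‖ := by
  classical
  calc ‖v‖ = ‖∑ i, v i • EuclideanSpace.basisFun ι ℝ i‖ := by
        exact congrArg norm ((EuclideanSpace.basisFun ι ℝ).sum_repr v).symm
    _ ≤ ∑ i, ‖v i • EuclideanSpace.basisFun ι ℝ i‖ := norm_sum_le _ _
    _ = ∑ i, ‖v i‖ := by simp [norm_smul]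

theorem norm_convolution_sub_gradient_potential_le {A B : E3 → E3} (h : HasWeakCurl A B)
    {K : Fin 3 → E3 → ℝ} (hK : ∀ i, IsTestFunction (K i)) (z : E3) :
    ‖((∑ i, partialDeriv i (K i)) ⋆ A) z - gradient (potential K A) z‖ ≤
      2 * ∑ i, ‖(K i ⋆ B) z‖ := by
  have hcoord (j : Fin 3) :
      ‖(((∑ i, partialDeriv i (K i)) ⋆ A) z - gradient (potential K A) z) j‖ ≤
        ‖(K (j + 2) ⋆ B) z‖ + ‖(K (j + 1) ⋆ B) z‖ := by
    rw [PiLp.sub_apply, gradient_potential_apply_eq h hK, sub_sub_cancel]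
    exact (norm_sub_le _ _).trans (add_le_add (PiLp.norm_apply_le _ _) (PiLp.norm_apply_le _ _))
  calc ‖((∑ i, partialDeriv i (K i)) ⋆ A) z - gradient (potential K A) z‖
      ≤ ∑ j, ‖(((∑ i, partialDeriv i (K i)) ⋆ A) z - gradient (potential K A) z) j‖ :=
        norm_le_sum_norm_apply _
    _ ≤ ∑ j : Fin 3, (‖(K (j + 2) ⋆ B) z‖ + ‖(K (j + 1) ⋆ B) z‖) :=
        Finset.sum_le_sum fun j _ => hcoord j
    _ = 2 * ∑ i, ‖(K i ⋆ B) z‖ := by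
        have hshift (c : Fin 3) : ∑ j, ‖(K (j + c) ⋆ B) z‖ = ∑ i, ‖(K i ⋆ B) z‖ :=
          Equiv.sum_comp (Equiv.addRight c) fun i => ‖(K i ⋆ B) z‖
        rw [Finset.sum_add_distrib, hshift, hshift, two_mul]

theorem eLpNorm_convolution_sub_gradient_potential_le {A B : E3 → E3} (h : HasWeakCurl A B)
    {K : Fin 3 → E3 → ℝ} (hK : ∀ i, IsTestFunction (K i)) {p : ℝ≥0∞} (hp : 1 ≤ p) :
    eLpNorm ((∑ i, partialDeriv i (K i)) ⋆ A - gradient (potential K A)) p ≤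
      2 * ∑ i, eLpNorm (K i ⋆ B) p := by
  have hKB (i : Fin 3) : AEStronglyMeasurable (fun z => ‖(K i ⋆ B) z‖) volume :=
    ((hK i).contDiff_convolution h.2.1).continuous.norm.aestronglyMeasurable
  have hsum : eLpNorm (∑ i, fun z => ‖(K i ⋆ B) z‖) p ≤ ∑ i, eLpNorm (K i ⋆ B) p := by
    simpa only [eLpNorm_norm] using eLpNorm_sum_le (fun i _ => hKB i) hp
  refine (eLpNorm_mono_real (g := (2 : ℝ) • ∑ i, fun z => ‖(K i ⋆ B) z‖) fun z => ?_).trans ?_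
  · rw [Pi.smul_apply, Finset.sum_apply, smul_eq_mul]
    exact norm_convolution_sub_gradient_potential_le h hK z
  · rw [eLpNorm_const_smul, Real.enorm_of_nonneg zero_le_two, ENNReal.ofReal_ofNat]
    gcongr

theorem modGradNorm_le_add_eLpNorm_convolution {A B : E3 → E3} (hA : MemLp A 3)
    (h : HasWeakCurl A B) {K : Fin 3 → E3 → ℝ} (hK : ∀ i, IsTestFunction (K i)) :
    modGradNorm A ≤ eLpNorm (A - (∑ i, partialDeriv i (K i)) ⋆ A) 3 +
      2 * ∑ i, eLpNorm (K i ⋆ B) 3 := by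
  have hgrad : MemLp (gradient (potential K A)) 3 :=
    memLp_gradient_potential hK (by norm_num) (by norm_num) hA
  have hdiv : AEStronglyMeasurable ((∑ i, partialDeriv i (K i)) ⋆ A) volume :=
    ((IsTestFunction.sum Finset.univ fun i => (hK i).partialDeriv i).contDiff_convolution
      h.1).continuous.aestronglyMeasurable
  refine (modGradNorm_le_of_contDiff (contDiff_potential hK h.1) hgrad).trans ?_
  rw [← sub_add_sub_cancel A ((∑ i, partialDeriv i (K i)) ⋆ A)]
  exact (eLpNorm_add_le (hA.1.sub hdiv) (hdiv.sub hgrad.1) (by norm_num)).trans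
    (add_le_add_right (eLpNorm_convolution_sub_gradient_potential_le h hK (by norm_num)) _)

end Curl

/-! ### Concentration of the curl at some scale -/

section Concentration

open scoped Convolution

/-- The sum `∑ k < n, (ε * 2 ^ k) • dilate (ε * 2 ^ k) Ψ`, which truncates the Newtonian kernel
`∫ dilate t Ψ dt` to the scales between `ε` and `ε * 2 ^ n`. -/
noncomputable def dyadicKernel (Ψ : E3 → ℝ) (ε : ℝ) (n : ℕ) : E3 → ℝ :=
  ∑ k ∈ Finset.range n, (ε * 2 ^ k) • dilate (ε * 2 ^ k) Ψ

theorem isTestFunction_smul_dilate {Ψ : E3 → ℝ} (hΨ : IsTestFunction Ψ) {ε : ℝ} (hε : ε ≠ 0)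
    (k : ℕ) : IsTestFunction ((ε * 2 ^ k) • dilate (ε * 2 ^ k) Ψ) :=
  (hΨ.dilate (mul_ne_zero hε (by positivity))).const_smul _

theorem isTestFunction_dyadicKernel {Ψ : E3 → ℝ} (hΨ : IsTestFunction Ψ) {ε : ℝ} (hε : ε ≠ 0)
    (n : ℕ) : IsTestFunction (dyadicKernel Ψ ε n) :=
  IsTestFunction.sum _ (isTestFunction_smul_dilate hΨ hε)

theorem dyadicKernel_convolution {Ψ : E3 → ℝ} (hΨ : IsTestFunction Ψ) {f : E3 → E3}
    (hf : LocallyIntegrable f) {ε : ℝ} (hε : ε ≠ 0) (n : ℕ) :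
    dyadicKernel Ψ ε n ⋆ f = ∑ k ∈ Finset.range n, (ε * 2 ^ k) • (dilate (ε * 2 ^ k) Ψ ⋆ f) := by
  simp only [dyadicKernel, sum_convolution _ (isTestFunction_smul_dilate hΨ hε) hf,
    smul_convolution]

theorem sum_partialDeriv_dyadicKernel {ρ : E3 → ℝ} {Ψ : Fin 3 → E3 → ℝ} (h : IsTelescoping ρ Ψ)
    {ε : ℝ} (hε : ε ≠ 0) (n : ℕ) :
    ∑ i, partialDeriv i (dyadicKernel (Ψ i) ε n) = dilate ε ρ - dilate (ε * 2 ^ n) ρ := by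
  have hscale (k : ℕ) : ε * 2 ^ k ≠ 0 := mul_ne_zero hε (by positivity)
  have hdiff (i : Fin 3) (k : ℕ) : Differentiable ℝ ((ε * 2 ^ k) • dilate (ε * 2 ^ k) (Ψ i)) :=
    (isTestFunction_smul_dilate (h.isTestFunction i) hε k).1.differentiable (by simp)
  have hterm (k : ℕ) :
      ∑ i, dilate (ε * 2 ^ k) (partialDeriv i (Ψ i)) =
        dilate (ε * 2 ^ k) ρ - dilate (ε * 2 ^ (k + 1)) ρ := by
    rw [← dilate_sum, h.sum_partialDeriv, dilate_sub, dilate_dilate, pow_succ, mul_assoc]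
  calc ∑ i, partialDeriv i (dyadicKernel (Ψ i) ε n)
      = ∑ i, ∑ k ∈ Finset.range n, dilate (ε * 2 ^ k) (partialDeriv i (Ψ i)) := by
        simp only [dyadicKernel, partialDeriv_sum _ fun k _ => hdiff _ k,
          partialDeriv_const_smul, partialDeriv_dilate, smul_inv_smul₀ (hscale _)]
    _ = ∑ k ∈ Finset.range n, (dilate (ε * 2 ^ k) ρ - dilate (ε * 2 ^ (k + 1)) ρ) := by
        rw [Finset.sum_comm]
        simp only [hterm]
    _ = dilate ε ρ - dilate (ε * 2 ^ n) ρ := by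
        rw [Finset.sum_range_sub', pow_zero, mul_one]

theorem sum_partialDeriv_dyadicKernel_convolution {ρ : E3 → ℝ} {Ψ : Fin 3 → E3 → ℝ}
    (h : IsTelescoping ρ Ψ) {f : E3 → E3} (hf : LocallyIntegrable f) {ε : ℝ} (hε : ε ≠ 0) (n : ℕ) :
    (∑ i, partialDeriv i (dyadicKernel (Ψ i) ε n)) ⋆ f =
      dilate ε ρ ⋆ f - dilate (ε * 2 ^ n) ρ ⋆ f := by
  have hexists {t : ℝ} (ht : t ≠ 0) (z : E3) : Integrable fun y => dilate t ρ (z - y) • f y :=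
    (convolutionExists_dilate h.continuous h.hasCompactSupport hf ht z).integrable_swap
  ext1 z
  rw [sum_partialDeriv_dyadicKernel h hε, Pi.sub_apply]
  simp only [convolution_lsmul_swap, Pi.sub_apply, sub_smul]
  exact integral_sub (hexists hε z) (hexists (mul_ne_zero hε (by positivity)) z)

theorem modGradNorm_le_of_isTelescoping {ρ : E3 → ℝ} {Ψ : Fin 3 → E3 → ℝ} (h : IsTelescoping ρ Ψ)
    {A B : E3 → E3} (hA : MemLp A 3) (hcurl : HasWeakCurl A B) {N : ℝ≥0∞}
    (hN : ∀ ε, 0 < ε → ∀ n, 2 * ∑ i, eLpNorm (dyadicKernel (Ψ i) ε n ⋆ B) 3 ≤ N) :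
    modGradNorm A ≤ N := by
  have hbound (ε : ℝ) (hε : 0 < ε) (n : ℕ) : modGradNorm A ≤
      eLpNorm (A - dilate ε ρ ⋆ A) 3 + eLpNorm (dilate (ε * 2 ^ n) ρ ⋆ A) 3 + N := by
    have hmeas {t : ℝ} (ht : t ≠ 0) : AEStronglyMeasurable (dilate t ρ ⋆ A) volume :=
      (continuous_dilate_convolution h.continuous h.hasCompactSupport hcurl.1
        ht).aestronglyMeasurable
    refine (modGradNorm_le_add_eLpNorm_convolution hA hcurl fun i =>
      isTestFunction_dyadicKernel (h.isTestFunction i) hε.ne' n).trans (add_le_add ?_ (hN ε hε n))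
    rw [sum_partialDeriv_dyadicKernel_convolution h hcurl.1 hε.ne', ← sub_add]
    exact eLpNorm_add_le (hA.1.sub (hmeas hε.ne')) (hmeas (by positivity)) (by norm_num)
  have hlarge (ε : ℝ) (hε : 0 < ε) : modGradNorm A ≤ eLpNorm (A - dilate ε ρ ⋆ A) 3 + N := by
    have hscale : Tendsto (fun n : ℕ => ε * 2 ^ n) atTop atTop :=
      (tendsto_pow_atTop_atTop_of_one_lt one_lt_two).const_mul_atTop hε
    have hlim := ((tendsto_eLpNorm_dilate_convolution_atTop h.continuous h.hasCompactSupport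
      (by norm_num) (by norm_num) hA).comp hscale).const_add (eLpNorm (A - dilate ε ρ ⋆ A) 3)
    rw [add_zero] at hlim
    exact ge_of_tendsto' (hlim.add_const N) (hbound ε hε)
  have hsmall := (tendsto_eLpNorm_sub_dilate_convolution h.continuous h.hasCompactSupport
    h.nonneg h.integral_eq_one (by norm_num) (by norm_num) hA).add_const N
  rw [zero_add] at hsmall
  exact ge_of_tendsto hsmall (eventually_mem_nhdsWithin.mono hlarge)

theorem exists_eLpNorm_dyadicKernel_convolution_le {Ψ : E3 → ℝ} (hΨ : IsTestFunction Ψ) :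
    ∃ c : ℝ≥0∞, c ≠ ⊤ ∧ ∀ (B : E3 → E3) (s : ℝ), LocallyIntegrable B → 0 < s →
      (∀ t z, 0 < t → t ^ 2 * ‖(dilate t Ψ ⋆ B) z‖ ≤ s) → ∀ ε, 0 < ε → ∀ n,
        eLpNorm (dyadicKernel Ψ ε n ⋆ B) 3 ≤
          c * (ENNReal.ofReal s * eLpNorm B (3 / 2)) ^ (1 / 2 : ℝ) := by
  have hfin : eLpNorm Ψ 1 ≠ ⊤ := hΨ.memLp.eLpNorm_ne_top
  set W : ℝ := (eLpNorm Ψ 1).toReal + 1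
  have hW0 : 0 < W := by positivity
  have hW : eLpNorm Ψ 1 ≤ ENNReal.ofReal W :=
    (ENNReal.le_ofReal_iff_toReal_le hfin hW0.le).2 (le_add_of_nonneg_right zero_le_one)
  have hp : (1 : ℝ≥0∞) < 3 / 2 := by
    rw [ENNReal.lt_div_iff_mul_lt (by simp) (by simp)]
    norm_num
  set c₀ : ℝ≥0∞ := ENNReal.ofReal ((3 / 2 : ℝ≥0∞).toReal / ((3 / 2 : ℝ≥0∞).toReal - 1)) ^
    (1 / (2 * (3 / 2 : ℝ≥0∞).toReal))
  have hc₀ : c₀ ≠ ⊤ := ENNReal.rpow_ne_top_of_nonneg (by positivity) ENNReal.ofReal_ne_top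
  refine ⟨c₀ * ENNReal.ofReal (32 * W) ^ (1 / 2 : ℝ), by finiteness,
    fun B s hB hs h ε hε n => ?_⟩
  have hle := eLpNorm_sum_dyadic_smul_convolution_le hΨ.1.continuous hΨ.2 hW0 hW hB hs
    (fun t ht z => h t z ht) hε n hp (by finiteness)
  rwa [← dyadicKernel_convolution hΨ hB hε.ne',
    ENNReal.mul_div_cancel two_ne_zero ENNReal.ofNat_ne_top, ENNReal.ofReal_mul (by positivity),
    mul_assoc (ENNReal.ofReal (32 * W)), ENNReal.mul_rpow_of_nonneg _ _ (by positivity),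
    ← mul_assoc] at hle

theorem exists_modGradNorm_le_rpow {ρ : E3 → ℝ} {Ψ : Fin 3 → E3 → ℝ} (h : IsTelescoping ρ Ψ) :
    ∃ c : ℝ≥0∞, c ≠ ⊤ ∧ ∀ (A B : E3 → E3) (s : ℝ), MemLp A 3 → HasWeakCurl A B → 0 < s →
      (∀ i t z, 0 < t → t ^ 2 * ‖(dilate t (Ψ i) ⋆ B) z‖ ≤ s) →
      modGradNorm A ≤ c * (ENNReal.ofReal s * eLpNorm B (3 / 2)) ^ (1 / 2 : ℝ) := by
  choose c hc hbound using fun i =>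
    exists_eLpNorm_dyadicKernel_convolution_le (h.isTestFunction i)
  refine ⟨2 * ∑ i, c i, ENNReal.mul_ne_top (by simp) (ENNReal.sum_ne_top.2 fun i _ => hc i),
    fun A B s hA hcurl hs hscale =>
      modGradNorm_le_of_isTelescoping h hA hcurl fun ε hε n => ?_⟩
  rw [mul_assoc, Finset.sum_mul]
  gcongr with i
  exact hbound i B s hcurl.2.1 hs (hscale i) ε hε n

theorem exists_lt_norm_dilate_convolution {ρ : E3 → ℝ} {Ψ : Fin 3 → E3 → ℝ}
    (h : IsTelescoping ρ Ψ) {δ C : ℝ≥0∞} (hδ : δ ≠ 0) (hC : C ≠ ⊤) :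
    ∃ s : ℝ, 0 < s ∧ ∀ A B : E3 → E3, MemLp A 3 → HasWeakCurl A B → δ ≤ modGradNorm A →
      eLpNorm B (3 / 2) ≤ C → ∃ i t z, 0 < t ∧ s < t ^ 2 * ‖(dilate t (Ψ i) ⋆ B) z‖ := by
  obtain ⟨c, hc, hbound⟩ := exists_modGradNorm_le_rpow h
  have hlim : Tendsto (fun s : ℝ => c * (ENNReal.ofReal s * C) ^ (1 / 2 : ℝ)) (𝓝[>] 0) (𝓝 0) := by
    have hcont : Continuous fun s : ℝ => c * (ENNReal.ofReal s * C) ^ (1 / 2 : ℝ) :=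
      (ENNReal.continuous_const_mul hc).comp (ENNReal.continuous_rpow_const.comp
        ((ENNReal.continuous_mul_const hC).comp ENNReal.continuous_ofReal))
    simpa using (hcont.tendsto 0).mono_left nhdsWithin_le_nhds
  obtain ⟨s, hsδ, hs⟩ :=
    ((hlim.eventually_lt_const (pos_iff_ne_zero.2 hδ)).and self_mem_nhdsWithin).exists
  refine ⟨s, hs, fun A B hA hcurl hAδ hBC => ?_⟩
  by_contra! hscale
  refine (hAδ.trans ((hbound A B s hA hcurl hs hscale).trans ?_)).not_gt hsδ
  gcongr

end Concentration

/-! ### Rescaled fields -/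

section Rescaling

open scoped Convolution

/-- The field `x ↦ t ^ 2 • B (t • (x - a))`, the action of dilations and translations on curls
that preserves the `L^{3/2}` norm. -/
noncomputable def rescale (t : ℝ) (a : E3) (B : E3 → E3) (x : E3) : E3 :=
  t ^ 2 • B (t • (x - a))

theorem eLpNorm_rescale (B : E3 → E3) {t : ℝ} (ht : 0 < t) (a : E3) :
    eLpNorm (rescale t a B) (3 / 2) = eLpNorm B (3 / 2) := by
  have htranslate : eLpNorm (fun x => B (t • (x - a))) (3 / 2) =
      eLpNorm (fun x => B (t • x)) (3 / 2) := by
    have hemb := (MeasurableEquiv.subRight a).measurableEmbedding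
    have hmap : Measure.map (MeasurableEquiv.subRight a) volume = (volume : Measure E3) :=
      map_sub_right_eq_self volume a
    have hcomp := hemb.eLpNorm_map_measure (g := fun x => B (t • x)) (p := 3 / 2) (μ := volume)
    rw [hmap] at hcomp
    exact hcomp.symm
  have hscale : ENNReal.ofReal |(t ^ Module.finrank ℝ E3)⁻¹| ^ (1 / (3 / 2 : ℝ≥0∞)).toReal =
      ENNReal.ofReal (t ^ 2)⁻¹ := by
    have hexp : (1 / (3 / 2 : ℝ≥0∞)).toReal = 2 / 3 := by
      rw [one_div, ENNReal.toReal_inv, ENNReal.toReal_div, ENNReal.toReal_ofNat,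
        ENNReal.toReal_ofNat, inv_div]
    rw [hexp, finrank_euclideanSpace_fin, abs_of_pos (by positivity),
      ENNReal.ofReal_rpow_of_pos (by positivity), Real.inv_rpow (by positivity),
      ← Real.rpow_natCast_mul ht.le]
    norm_num
  have hrescale : rescale t a B = t ^ 2 • fun x => B (t • (x - a)) := rfl
  rw [hrescale, eLpNorm_const_smul, htranslate, eLpNorm_comp_smul B ht.ne' (by finiteness), hscale,
    Real.enorm_eq_ofReal (by positivity), ← mul_assoc, ← ENNReal.ofReal_mul (by positivity),
    mul_inv_cancel₀ (by positivity), ENNReal.ofReal_one, one_mul]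

theorem integral_comp_neg_smul_rescale (w : E3 → ℝ) (B : E3 → E3) {t : ℝ} (ht : 0 < t) (z : E3) :
    ∫ x, w (-x) • rescale t (-(t⁻¹ • z)) B x = t ^ 2 • (dilate t w ⋆ B) z := by
  have hflip : ∫ x, w (-x) • rescale t (-(t⁻¹ • z)) B x = ∫ x, t ^ 2 • w x • B (z - t • x) := by
    rw [← integral_neg_eq_self]
    refine integral_congr_ae (ae_of_all _ fun x => ?_)
    simp only [rescale, neg_neg, sub_neg_eq_add, smul_sub, neg_add_eq_sub,
      smul_inv_smul₀ ht.ne', smul_comm (w x)]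
  have hscale := Measure.integral_comp_smul_of_nonneg volume
    (fun y => w (t⁻¹ • y) • B (z - y)) (hR := ht.le)
  simp only [inv_smul_smul₀ ht.ne'] at hscale
  rw [hflip, integral_smul, hscale, ← integral_smul]
  simp only [convolution_lsmul, dilate, mul_smul]

theorem memLp_rescale {B : E3 → E3} (hB : MemLp B (3 / 2)) {t : ℝ} (ht : 0 < t) (a : E3) :
    MemLp (rescale t a B) (3 / 2) := by
  have hpres : Measure.QuasiMeasurePreserving fun x : E3 => t • (x - a) :=
    (Measure.quasiMeasurePreserving_smul volume ht.ne').comp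
      (measurePreserving_sub_right volume a).quasiMeasurePreserving
  exact ⟨(hB.1.comp_quasiMeasurePreserving hpres).const_smul (t ^ 2),
    (eLpNorm_rescale B ht a).trans_lt hB.2⟩

end Rescaling

/-! ### Weak limits -/

section WeakLimit

open scoped Convolution

theorem tendsto_apply_of_forall_dual {α X ι : Type*} [Finite ι] [NormedAddCommGroup X]
    [NormedSpace ℝ X] {l : Filter α} {u : α → X} {v : X}
    (h : ∀ ℓ : StrongDual ℝ X, Tendsto (fun k => ℓ (u k)) l (𝓝 (ℓ v)))
    (T : X →L[ℝ] EuclideanSpace ℝ ι) : Tendsto (fun k => T (u k)) l (𝓝 (T v)) := by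
  cases nonempty_fintype ι
  rw [(EuclideanSpace.equiv ι ℝ).toHomeomorph.isInducing.tendsto_nhds_iff, tendsto_pi_nhds]
  exact fun i => h ((EuclideanSpace.proj i).comp T)

theorem TendstoWeaklyLp.tendsto_integral_smul {p q : ℝ≥0∞} [Fact (1 ≤ p)] [Fact (1 ≤ q)]
    [q.HolderConjugate p] {u : ℕ → E3 → E3} {v : E3 → E3} (h : TendstoWeaklyLp p u v) {w : E3 → ℝ}
    (hw : MemLp w q) : Tendsto (fun k => ∫ x, w x • u k x) atTop (𝓝 (∫ x, w x • v x)) := by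
  obtain ⟨hu, hv, hdual⟩ := h
  have hpairing {f : E3 → E3} (hf : MemLp f p) :
      ContinuousLinearMap.lpPairing volume q p (ContinuousLinearMap.lsmul ℝ ℝ) (hw.toLp w)
        (hf.toLp f) = ∫ x, w x • f x := by
    rw [ContinuousLinearMap.lpPairing_eq_integral]
    refine integral_congr_ae ?_
    filter_upwards [hw.coeFn_toLp, hf.coeFn_toLp] with x hwx hfx
    rw [hwx, hfx, ContinuousLinearMap.lsmul_apply]
  simpa only [hpairing] using tendsto_apply_of_forall_dual hdual
    (ContinuousLinearMap.lpPairing volume q p (ContinuousLinearMap.lsmul ℝ ℝ) (hw.toLp w))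

theorem TendstoWeaklyLp.not_ae_eq_zero {p q : ℝ≥0∞} [Fact (1 ≤ p)] [Fact (1 ≤ q)]
    [q.HolderConjugate p] {u : ℕ → E3 → E3} {v : E3 → E3} (h : TendstoWeaklyLp p u v)
    {ι : Type*} [Finite ι] {w : ι → E3 → ℝ} (hw : ∀ j, MemLp (w j) q) {s : ℝ} (hs : 0 < s)
    (hlt : ∀ k, ∃ j, s < ‖∫ x, w j x • u k x‖) : ¬ v =ᵐ[volume] 0 := by
  intro hv
  have hlim (j : ι) : Tendsto (fun k => ‖∫ x, w j x • u k x‖) atTop (𝓝 0) := by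
    have hzero : ∫ x, w j x • v x = 0 :=
      integral_eq_zero_of_ae (hv.mono fun x hx => by simp [hx])
    simpa only [hzero, norm_zero] using (h.tendsto_integral_smul (hw j)).norm
  obtain ⟨k, hk⟩ := (eventually_all.2 fun j => (hlim j).eventually_lt_const hs).exists
  obtain ⟨j, hj⟩ := hlt k
  exact (hk j).not_gt hj

theorem exists_subseq_tendstoWeaklyLp {p q : ℝ≥0∞} [Fact (1 ≤ p)] [Fact (1 ≤ q)]
    [p.HolderConjugate q] (hp : p ≠ ⊤) (hq : q ≠ ⊤) {u : ℕ → E3 → E3} (hu : ∀ n, MemLp (u n) p)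
    {C : ℝ≥0} (hC : ∀ n, eLpNorm (u n) p ≤ C) :
    ∃ (v : E3 → E3) (ns : ℕ → ℕ), StrictMono ns ∧ TendstoWeaklyLp p (fun k => u (ns k)) v := by
  have hnorm (n : ℕ) : ‖(hu n).toLp (u n)‖ ≤ C := by
    rw [Lp.norm_toLp]
    exact ENNReal.toReal_le_coe_of_le_coe (hC n)
  obtain ⟨v, ns, hns, hlim⟩ := exists_subseq_tendsto_dual (q := q) hp hq hnorm
  refine ⟨v, ns, hns, fun k => hu (ns k), Lp.memLp v, fun ℓ => ?_⟩
  rw [Lp.toLp_coeFn]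
  exact hlim ℓ

instance holderConjugate_three_halves_three : ENNReal.HolderConjugate (3 / 2) 3 := by
  refine ENNReal.HolderConjugate.of_toReal ?_
  rw [Real.holderConjugate_iff]
  norm_num

theorem proposition7_general (A B : ℕ → E3 → E3) (hA : ∀ n, MemLp (A n) 3)
    (hB : ∀ n, HasWeakCurl (A n) (B n)) {δ : ℝ≥0∞} (hδ : δ ≠ 0) (hnorm : ∀ n, δ ≤ modGradNorm (A n))
    (hbdd : ∃ C : ℝ≥0, ∀ n, eLpNorm (B n) (3 / 2) volume ≤ C) :
    ∃ (lam : ℕ → ℝ) (a : ℕ → E3), (∀ n, 0 < lam n) ∧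
      ∃ ns : ℕ → ℕ, StrictMono ns ∧
        ∃ Btilde : E3 → E3, ¬ (Btilde =ᵐ[volume] 0) ∧
          TendstoWeaklyLp (3 / 2)
            (fun k x => (lam (ns k)) ^ 2 • B (ns k) (lam (ns k) • (x - a (ns k)))) Btilde := by
  obtain ⟨C, hC⟩ := hbdd
  obtain ⟨ρ, Ψ, h⟩ := exists_isTelescoping
  obtain ⟨s, hs, hconc⟩ := exists_lt_norm_dilate_convolution h hδ (ENNReal.coe_ne_top (r := C))
  choose i t z ht hlt using fun n => hconc (A n) (B n) (hA n) (hB n) (hnorm n) (hC n)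
  set a : ℕ → E3 := fun n => -((t n)⁻¹ • z n) with ha
  have hmem (n : ℕ) : MemLp (rescale (t n) (a n) (B n)) (3 / 2) := memLp_rescale
    ⟨(hB n).2.1.aestronglyMeasurable, (hC n).trans_lt ENNReal.coe_lt_top⟩ (ht n) (a n)
  have : Fact ((1 : ℝ≥0∞) ≤ 3) := ⟨by norm_num⟩
  obtain ⟨v, ns, hns, hv⟩ := exists_subseq_tendstoWeaklyLp (q := 3) (by finiteness) (by simp) hmem
    fun n => (eLpNorm_rescale (B n) (ht n) (a n)).trans_le (hC n)
  have hΨ (j : Fin 3) : MemLp (fun x => Ψ j (-x)) 3 := by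
    simpa only [zero_sub] using ((h.isTestFunction j).comp_sub_left 0).memLp
  refine ⟨t, a, ht, ns, hns, v, hv.not_ae_eq_zero hΨ hs fun k => ⟨i (ns k), ?_⟩, hv⟩
  rw [ha, integral_comp_neg_smul_rescale _ _ (ht _), norm_smul, norm_pow,
    Real.norm_of_nonneg (ht _).le]
  exact hlt (ns k)

end WeakLimit

theorem proposition7 (A B : ℕ → E3 → E3)
    (hA : ∀ n, A n ∈ SpaceY)
    (hB : ∀ n, HasWeakCurl (A n) (B n))
    (hnorm : ∀ n, modGradNorm (A n) = 1)
    (hbdd : ∃ C : ℝ≥0, ∀ n, eLpNorm (B n) (3 / 2) volume ≤ C) :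
    ∃ (lam : ℕ → ℝ) (a : ℕ → E3), (∀ n, 0 < lam n) ∧
      ∃ ns : ℕ → ℕ, StrictMono ns ∧
        ∃ Btilde : E3 → E3, ¬ (Btilde =ᵐ[volume] 0) ∧
          TendstoWeaklyLp (3 / 2)
            (fun k x => (lam (ns k)) ^ 2 • B (ns k) (lam (ns k) • (x - a (ns k)))) Btilde :=
  proposition7_general A B (fun n => (hA n).1) hB one_ne_zero (fun n => (hnorm n).ge) hbdd
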